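/- Let $\rho_{AB}$ be a state (density matrix) on $\mathbb{C}^{d_A}\otimes\mathbb{C}^{d_B}$, let $d=d_Ad_B$ with $d>2$, and let $\mu$ be the normalized Haar measure on the unitary group $\mathrm{U}(d)$. For $U\in\mathrm{U}(d)$ put $\rho'_{AB}=U\rho_{AB}U^\dagger$, with marginals $\rho'_A=\mathrm{Tr}_B\,\rho'_{AB}$ and $\rho'_B=\mathrm{Tr}_A\,\rho'_{AB}$. Let $S(\rho\|\sigma)=\mathrm{Tr}\,\rho(\ln\rho-\ln\sigma)$ be the relative entropy (equal to $+\infty$ if the support of $\rho$ is not contained in that of $\sigma$), $I(A:B)_\rho=S(\rho_{AB}\|\rho_A\otimes\rho_B)$ the mutual information, and $F(\rho,\sigma)=\mathrm{Tr}\sqrt{\sqrt\rho\,\sigma\sqrt\rho}$ the fidelity. Put $$c_0=\frac{(d_A^2-1)(d_B^2-1)}{(d^2-1)(d^2-4)}\bigl(d-2\,\mathrm{Tr}\,\rho_{AB}^2\bigr),\quad c_1=\frac{d^2(d_A^2+d_B^2-6)+4}{(d^2-1)(d^2-4)},\quad c_2=\frac{2d(d_A^2-1)(d_B^2-1)}{(d^2-1)(d^2-4)}.$$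 Then $I(A:B)_{\rho'}$ is finite for every $U$, both $I(A:B)_{\rho'}$ and $F(\rho'_{AB},\rho'_A\otimes\rho'_B)$ are $\mu$-integrable functions of $U$, and $$\int I(A:B)_{\rho'}\,d\mu(U)\ \ge\ S\bigl(\rho_{AB}\,\big\|\,c_0\mathbb{1}+c_1\rho_{AB}+c_2\rho_{AB}^2\bigr);$$ in particular $I(A:B)_{\rho'}\ge S(\rho_{AB}\|c_0\mathbb{1}+c_1\rho_{AB}+c_2\rho_{AB}^2)$ for some $U$, so that the right-hand side is a lower bound for the maximal mutual information within the orbit. Moreover $$c_0+c_1\mathrm{Tr}\,\rho_{AB}^2+c_2\mathrm{Tr}\,\rho_{AB}^3\ \le\ \int F(\rho'_{AB},\rho'_A\otimes\rho'_B)\,d\mu(U)\ \le\ F\bigl(\rho_{AB},\,c_0\mathbb{1}+c_1\rho_{AB}+c_2\rho_{AB}^2\bigr).$$ -/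

import Mathlib

open MeasureTheory
open scoped Kronecker ComplexOrder

noncomputable section

namespace UnitaryOrbit

/-! ### The normalized Haar measure on the unitary group -/

instance unitaryGroup_compactSpace {n : Type*} [Fintype n] [DecidableEq n] :
    CompactSpace (Matrix.unitaryGroup n ℂ) := by
  suffices h : IsCompact (Matrix.unitaryGroup n ℂ : Set (Matrix n n ℂ)) from
    isCompact_iff_compactSpace.mp h
  have hK : IsCompact (Set.univ.pi fun _ : n => Set.univ.pi fun _ : n =>
      Metric.closedBall (0 : ℂ) 1) :=
    isCompact_univ_pi fun _ => isCompact_univ_pi fun _ => isCompact_closedBall 0 1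
  refine hK.of_isClosed_subset (isClosed_unitary (R := Matrix n n ℂ)) ?_
  intro U hU i _ j _
  rw [mem_closedBall_zero_iff]
  exact entry_norm_bound_of_unitary hU i j

instance unitaryGroup_measurableSpace {n : Type*} [Fintype n] [DecidableEq n] :
    MeasurableSpace (Matrix.unitaryGroup n ℂ) := borel _

instance unitaryGroup_borelSpace {n : Type*} [Fintype n] [DecidableEq n] :
    BorelSpace (Matrix.unitaryGroup n ℂ) := ⟨rfl⟩

/-- The Haar measure on the compact group of unitary matrices, normalized to total mass one. -/
def unitaryHaar (n : Type*) [Fintype n] [DecidableEq n] : Measure (Matrix.unitaryGroup n ℂ) :=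
  Measure.haarMeasure ⊤

/-! ### States, marginals and the unitary orbit -/

/-- A state (density matrix): positive semidefinite with unit trace. -/
structure IsState {n : Type*} [Fintype n] (ρ : Matrix n n ℂ) : Prop where
  posSemidef : ρ.PosSemidef
  trace_eq_one : ρ.trace = 1

variable {A B n : Type*} [Fintype A] [Fintype B] [Fintype n]

/-- The marginal on `A`: the partial trace over `B`. -/
def marginalA (ρ : Matrix (A × B) (A × B) ℂ) : Matrix A A ℂ :=
  Matrix.of fun i j => ∑ b, ρ (i, b) (j, b)

/-- The marginal on `B`: the partial trace over `A`. -/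
def marginalB (ρ : Matrix (A × B) (A × B) ℂ) : Matrix B B ℂ :=
  Matrix.of fun i j => ∑ a, ρ (a, i) (a, j)

/-- The tensor product of the two marginals. -/
def marginalProduct (ρ : Matrix (A × B) (A × B) ℂ) : Matrix (A × B) (A × B) ℂ :=
  marginalA ρ ⊗ₖ marginalB ρ

variable [DecidableEq A] [DecidableEq B] [DecidableEq n]

/-- The point `U ρ U†` of the unitary orbit of `ρ`. -/
def orbit (ρ : Matrix n n ℂ) (U : Matrix.unitaryGroup n ℂ) : Matrix n n ℂ :=
  (U : Matrix n n ℂ) * ρ * star (U : Matrix n n ℂ)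

/-! ### Relative entropy, mutual information, fidelity -/

open scoped Classical in
/-- Relative entropy `Tr ρ (ln ρ - ln σ)` when the support of `ρ` is contained in the support
of `σ` (equivalently `ker σ ⊆ ker ρ`), and `+∞` otherwise. Since `Real.log 0 = 0`, the functional
calculus takes the logarithm on the supports only, so that `0 ln 0 = 0`. -/
def relativeEntropy (ρ σ : Matrix n n ℂ) : EReal :=
  if ∀ v : n → ℂ, σ.mulVec v = 0 → ρ.mulVec v = 0 then
    (((ρ * (cfc Real.log ρ - cfc Real.log σ)).trace.re : ℝ) : EReal)
  else ⊤

/-- Quantum mutual information `I(A:B)_ρ = S(ρ ‖ ρ_A ⊗ ρ_B)`. -/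
def mutualInformation (ρ : Matrix (A × B) (A × B) ℂ) : EReal :=
  relativeEntropy ρ (marginalProduct ρ)

/-- Fidelity `Tr √(√ρ σ √ρ)`. -/
def fidelity (ρ σ : Matrix n n ℂ) : ℝ :=
  (cfc Real.sqrt (cfc Real.sqrt ρ * σ * cfc Real.sqrt ρ)).trace.re

/-! ### The coefficients -/

/-- `c₀ = (a² - 1)(b² - 1)(d - 2P) / ((d² - 1)(d² - 4))` with `d = ab`; here `a, b` are the
dimensions of the two systems and `P` is the purity of the state. -/
def c₀ (a b P : ℝ) : ℝ :=
  (a ^ 2 - 1) * (b ^ 2 - 1) / (((a * b) ^ 2 - 1) * ((a * b) ^ 2 - 4)) * (a * b - 2 * P)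

/-- `c₁ = (d² (a² + b² - 6) + 4) / ((d² - 1)(d² - 4))` with `d = ab`. -/
def c₁ (a b : ℝ) : ℝ :=
  ((a * b) ^ 2 * (a ^ 2 + b ^ 2 - 6) + 4) / (((a * b) ^ 2 - 1) * ((a * b) ^ 2 - 4))

/-- `c₂ = 2d (a² - 1)(b² - 1) / ((d² - 1)(d² - 4))` with `d = ab`. -/
def c₂ (a b : ℝ) : ℝ :=
  2 * (a * b) * (a ^ 2 - 1) * (b ^ 2 - 1) / (((a * b) ^ 2 - 1) * ((a * b) ^ 2 - 4))

/-- The matrix `c₀ 𝟙 + c₁ ρ + c₂ ρ²`. -/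
def quadraticState (ρ : Matrix (A × B) (A × B) ℂ) : Matrix (A × B) (A × B) ℂ :=
  (c₀ (Fintype.card A) (Fintype.card B) (ρ ^ 2).trace.re : ℂ) • (1 : Matrix (A × B) (A × B) ℂ) +
    (c₁ (Fintype.card A) (Fintype.card B) : ℂ) • ρ +
    (c₂ (Fintype.card A) (Fintype.card B) : ℂ) • ρ ^ 2

end UnitaryOrbit

end

open UnitaryOrbit

/-!
# Average mutual information and fidelity along a unitary orbit

Conjugating back by `U`, the mutual information and the fidelity of `U ρ U†` with the product of its
marginals become those of the fixed state `ρ` with the random state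
`σ_U = U† (ρ'_A ⊗ ρ'_B) U` (`pulledProduct`). Both bounds on the averages are then instances of
Jensen's inequality, by operator concavity of the logarithm and of the square root, once the mean
of `σ_U` is known to be `c₀ + c₁ ρ + c₂ ρ²` (`integral_pulledProduct`). The lower bound for the
fidelity is the pointwise estimate `Tr ρ σ ≤ F(ρ, σ)`, averaged.

*The mean.* It is enough to treat a diagonal `ρ` of trace one. Averaging over sign flips of basis
vectors shows that the mean is diagonal, and its diagonal is a quadratic form in the eigenvalues of
`ρ` whose coefficients `t_ijk` (`columnMoment`) are moments of three columns of a Haar unitary.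
Permuting columns, `t_ijk` depends only on which of the indices coincide, and summing over a free
index gives enough linear relations to reduce everything to the case of a single column
(`columnMoment_eq`). There one needs the first three moments of a random pure state
(`integral_pureState_mul_mul`). They satisfy a recursion, since the average of the derivative of any
function along the orbit vanishes in the direction of an arbitrary complex matrix
(`integral_orbit_derivation`).

*The logarithm.* Marginals may be singular, so Jensen's inequality is applied to the shifted
logarithm `ln (x + ε)`, which is continuous on states; as `ε → 0` the shifted values decrease to
`Tr ρ ln σ` because the kernel of `σ` is contained in that of `ρ`. For `σ_U` this inclusion is
`ker_marginalProduct_le`, and for the mean it follows because a vector annihilated by an average of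
positive matrices is annihilated by one of them. Integrability comes from writing the cross term of
the mutual information as a sum of marginal entropies, which are continuous in `U`.
-/

noncomputable section

namespace UnitaryOrbit

/-! ### Invariance of the Haar measure -/

section Haar

variable {n : Type*} [Fintype n] [DecidableEq n]

instance unitaryHaar_isHaarMeasure : (unitaryHaar n).IsHaarMeasure := by
  unfold unitaryHaar; infer_instance

instance unitaryHaar_isProbabilityMeasure : IsProbabilityMeasure (unitaryHaar n) :=
  ⟨by simpa [unitaryHaar] using
    Measure.haarMeasure_self (K₀ := (⊤ : TopologicalSpace.PositiveCompacts
      (Matrix.unitaryGroup n ℂ)))⟩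

/-- A compact group is unimodular: right translates of the Haar probability measure are again Haar
probability measures, and there is only one of these. -/
instance unitaryHaar_isMulRightInvariant : (unitaryHaar n).IsMulRightInvariant where
  map_mul_right_eq_self g := by
    have : IsProbabilityMeasure (Measure.map (fun U => U * g) (unitaryHaar n)) :=
      Measure.isProbabilityMeasure_map (measurable_mul_const g).aemeasurable
    exact Measure.isHaarMeasure_eq_of_isProbabilityMeasure _ _

theorem integrable_unitaryHaar {E : Type*} [NormedAddCommGroup E]
    {F : Matrix.unitaryGroup n ℂ → E} (hF : Continuous F) : Integrable F (unitaryHaar n) :=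
  hF.integrable_of_hasCompactSupport (HasCompactSupport.of_compactSpace F)

@[fun_prop]
theorem continuous_orbit (P : Matrix n n ℂ) : Continuous (orbit P) := by
  unfold orbit
  fun_prop

theorem orbit_mul (P : Matrix n n ℂ) (W U : Matrix.unitaryGroup n ℂ) :
    orbit P (W * U) = W * orbit P U * star (W : Matrix n n ℂ) := by
  simp [orbit, mul_assoc]

/-- The average over the group of a derivative along left translations vanishes. -/
theorem integral_derivative_eq_zero {F F' : Matrix.unitaryGroup n ℂ → ℂ} (hF : Continuous F)
    (hF' : Continuous F') (W : ℝ → Matrix.unitaryGroup n ℂ)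
    (h : ∀ t U, HasDerivAt (fun s => F (W s * U)) (F' (W t * U)) t) :
    ∫ U, F' U ∂(unitaryHaar n) = 0 := by
  obtain ⟨C, hC⟩ := (isCompact_univ (X := Matrix.unitaryGroup n ℂ)).exists_bound_of_continuousOn
    hF'.continuousOn
  have key := (hasDerivAt_integral_of_dominated_loc_of_deriv_le (μ := unitaryHaar n)
    (F := fun s U => F (W s * U)) (F' := fun s U => F' (W s * U)) (x₀ := (0 : ℝ))
    (bound := fun _ => C) Filter.univ_mem
    (Filter.Eventually.of_forall fun s =>
      (integrable_unitaryHaar (by fun_prop)).aestronglyMeasurable)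
    (integrable_unitaryHaar (by fun_prop))
    (integrable_unitaryHaar (by fun_prop)).aestronglyMeasurable
    (Filter.Eventually.of_forall fun U s _ => hC _ (Set.mem_univ _))
    (integrable_const C)
    (Filter.Eventually.of_forall fun U s _ => h s U)).2
  simp only [integral_mul_left_eq_self] at key
  exact key.unique (hasDerivAt_const _ _)

open scoped Matrix.Norms.L2Operator in
/-- Along the one-parameter group generated by `i H`, the orbit moves by the commutator with
`i H`. -/
theorem hasDerivAt_orbit (P : Matrix n n ℂ) (H : selfAdjoint (Matrix n n ℂ))
    (U : Matrix.unitaryGroup n ℂ) (t : ℝ) (i j : n) :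
    HasDerivAt (fun s : ℝ => orbit P (selfAdjoint.expUnitary (s • H) * U) i j)
      (((Complex.I • (H : Matrix n n ℂ)) * orbit P (selfAdjoint.expUnitary (t • H) * U) -
        orbit P (selfAdjoint.expUnitary (t • H) * U) * (Complex.I • (H : Matrix n n ℂ))) i j) t := by
  set X : Matrix n n ℂ := Complex.I • (H : Matrix n n ℂ) with hX
  have hXs : star X = -X := by
    rw [hX, star_smul, H.2.star_eq]
    simp
  have hW : ∀ s : ℝ, ((selfAdjoint.expUnitary (s • H) : unitary (Matrix n n ℂ)) :
      Matrix n n ℂ) = NormedSpace.exp (s • X) := by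
    intro s
    rw [selfAdjoint.expUnitary_coe, hX]
    congr 1
    exact smul_comm _ _ _
  have hWs : ∀ s : ℝ, star (NormedSpace.exp (s • X)) = NormedSpace.exp (s • (-X)) := by
    intro s
    rw [NormedSpace.star_exp, star_smul, hXs]
    simp
  have h1 := hasDerivAt_exp_smul_const' (𝕂 := ℝ) X t
  have h2 := hasDerivAt_exp_smul_const (𝕂 := ℝ) (-X) t
  have h3 := (h1.mul_const (orbit P U)).mul h2
  let e : Matrix n n ℂ →L[ℝ] ℂ := LinearMap.toContinuousLinearMap (Matrix.entryLinearMap ℝ ℂ i j)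
  have h4 := e.hasFDerivAt.comp_hasDerivAt t h3
  have hval : (Complex.I • (H : Matrix n n ℂ)) * orbit P (selfAdjoint.expUnitary (t • H) * U) -
      orbit P (selfAdjoint.expUnitary (t • H) * U) * (Complex.I • (H : Matrix n n ℂ)) =
      X * NormedSpace.exp (t • X) * orbit P U * NormedSpace.exp (t • -X) +
        NormedSpace.exp (t • X) * orbit P U * (NormedSpace.exp (t • -X) * -X) := by
    rw [← hX, orbit_mul, hW, hWs]
    noncomm_ring
  have hfun : ∀ s : ℝ, orbit P (selfAdjoint.expUnitary (s • H) * U) i j =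
      e (NormedSpace.exp (s • X) * orbit P U * NormedSpace.exp (s • -X)) := by
    intro s
    rw [orbit_mul, hW, hWs]
    rfl
  rw [hval]
  simp_rw [hfun]
  exact h4

/-- Invariance of the orbit average under infinitesimal conjugation. The function `D R` stands for
the derivative of `F` at `R`; being complex linear, it may be evaluated on the commutator with an
arbitrary matrix `X`, not only with the skew-Hermitian ones that generate unitaries. -/
theorem integral_orbit_derivation (P : Matrix n n ℂ) {F : Matrix n n ℂ → ℂ}
    {D : Matrix n n ℂ → Matrix n n ℂ → ℂ} (hF : Continuous F)
    (hD : ∀ X, Continuous fun R => D R (X * R - R * X))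
    (hlin : ∀ R X Y (c : ℂ), D R (X + c • Y) = D R X + c * D R Y)
    (hFD : ∀ (γ : ℝ → Matrix n n ℂ) (γ' : Matrix n n ℂ) (t : ℝ),
      (∀ i j, HasDerivAt (fun s => γ s i j) (γ' i j) t) →
        HasDerivAt (fun s => F (γ s)) (D (γ t) γ') t) (X : Matrix n n ℂ) :
    ∫ U, D (orbit P U) (X * orbit P U - orbit P U * X) ∂(unitaryHaar n) = 0 := by
  have hsa : ∀ H : selfAdjoint (Matrix n n ℂ), ∫ U, D (orbit P U)
      ((Complex.I • (H : Matrix n n ℂ)) * orbit P U - orbit P U * (Complex.I • (H : Matrix n n ℂ)))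
      ∂(unitaryHaar n) = 0 := fun H =>
    integral_derivative_eq_zero (F := fun U => F (orbit P U)) (by fun_prop)
      ((hD _).comp (continuous_orbit P)) _ fun t U =>
        hFD _ _ t (hasDerivAt_orbit P H U t)
  have hint : ∀ Y, Integrable (fun U => D (orbit P U) (Y * orbit P U - orbit P U * Y))
      (unitaryHaar n) := fun Y => integrable_unitaryHaar ((hD _).comp (continuous_orbit P))
  have hX : X = Complex.I • ((imaginaryPart X : selfAdjoint (Matrix n n ℂ)) : Matrix n n ℂ) +
      (-Complex.I) • (Complex.I • ((realPart X : selfAdjoint (Matrix n n ℂ)) : Matrix n n ℂ)) := by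
    conv_lhs => rw [← realPart_add_I_smul_imaginaryPart X]
    rw [smul_smul]
    simp [add_comm]
  have hsplit : ∀ (Y Z R : Matrix n n ℂ) (c : ℂ), (Y + c • Z) * R - R * (Y + c • Z) =
      (Y * R - R * Y) + c • (Z * R - R * Z) := by
    intro Y Z R c
    simp only [add_mul, mul_add, smul_mul_assoc, mul_smul_comm, smul_sub]
    abel
  -- both `i · Im X` and `i · Re X` generate unitaries, and `X` is a complex combination of them
  rw [hX]
  simp only [hsplit, hlin]
  rw [integral_add (hint _) ((hint _).const_mul _), integral_const_mul, hsa, hsa]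
  simp

end Haar

/-! ### Moments of a random pure state -/

section Moments

variable {n : Type*} [Fintype n] [DecidableEq n]

/-- The random pure state `U |x⟩⟨x| U†`, that is, the projection onto column `x` of `U`. -/
def pureState (x : n) (U : Matrix.unitaryGroup n ℂ) : Matrix n n ℂ :=
  orbit (Matrix.single x x 1) U

@[fun_prop]
theorem continuous_pureState (x : n) : Continuous (pureState x) := continuous_orbit _

@[fun_prop]
theorem continuous_pureState_apply (x i j : n) : Continuous fun U => pureState x U i j :=
  (continuous_pureState x).matrix_elem i j

theorem pureState_apply (x : n) (U : Matrix.unitaryGroup n ℂ) (i j : n) :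
    pureState x U i j = (U : Matrix n n ℂ) i x * star ((U : Matrix n n ℂ) j x) := by
  simp [pureState, orbit, Matrix.mul_apply, Matrix.single_apply, Finset.sum_ite_eq,
    ite_and, Matrix.star_apply]

/-- A pure state has rank one, so that the column indices of two entries can be exchanged. -/
theorem pureState_mul_swap (x : n) (U : Matrix.unitaryGroup n ℂ) (i j k l : n) :
    pureState x U i j * pureState x U k l = pureState x U i l * pureState x U k j := by
  simp only [pureState_apply]
  ring

theorem trace_orbit (P : Matrix n n ℂ) (U : Matrix.unitaryGroup n ℂ) :
    (orbit P U).trace = P.trace := by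
  rw [orbit, Matrix.trace_mul_cycle]
  simp

theorem sum_pureState_diag (x : n) (U : Matrix.unitaryGroup n ℂ) :
    ∑ p, pureState x U p p = 1 := by
  have h := trace_orbit (Matrix.single x x (1 : ℂ)) U
  rw [Matrix.trace_single_eq_same] at h
  exact h

theorem sum_pureState_mul (x : n) (U : Matrix.unitaryGroup n ℂ) (j l : n) :
    ∑ p, pureState x U p l * pureState x U j p = pureState x U j l := by
  simp_rw [fun p => pureState_mul_swap x U p l j p]
  rw [← Finset.sum_mul, sum_pureState_diag, one_mul]

theorem single_commutator_apply (R : Matrix n n ℂ) (p i a b : n) :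
    (Matrix.single p i (1 : ℂ) * R - R * Matrix.single p i (1 : ℂ)) a b =
      (1 : Matrix n n ℂ) a p * R i b - R a p * (1 : Matrix n n ℂ) i b := by
  simp [Matrix.mul_apply, Matrix.single_apply, Matrix.one_apply, ite_and, eq_comm]

/-- The first moment of a random pure state `R`. As for the higher moments below, the invariance of
the average of a monomial starting with `R p l` in the direction of the matrix unit `E p i` is
summed over `p`; since `∑ p, R p p = 1` and `R` has rank one, this expresses the moment through
those of lower degree. -/
theorem integral_pureState (x i l : n) :
    ∫ U, pureState x U i l ∂(unitaryHaar n) =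
      (1 : Matrix n n ℂ) i l / Fintype.card n := by
  have hder : ∀ p, ∫ U, ((1 : Matrix n n ℂ) p p * pureState x U i l -
      pureState x U p p * (1 : Matrix n n ℂ) i l) ∂(unitaryHaar n) = 0 := by
    intro p
    simpa only [single_commutator_apply] using! integral_orbit_derivation (Matrix.single x x 1)
      (F := fun R => R p l) (D := fun R Y => Y p l) (by fun_prop) (fun X => by fun_prop)
      (fun R X Y c => by simp) (fun γ γ' t h => h p l) (Matrix.single p i 1)
  have hcard : (Fintype.card n : ℂ) ≠ 0 := by
    have : Nonempty n := ⟨x⟩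
    exact_mod_cast Fintype.card_ne_zero
  have hsum := Finset.sum_eq_zero fun p (_ : p ∈ Finset.univ) => hder p
  rw [← integral_finsetSum _ fun p _ => integrable_unitaryHaar (by fun_prop)] at hsum
  have hpt : ∀ U : Matrix.unitaryGroup n ℂ, ∑ p, ((1 : Matrix n n ℂ) p p * pureState x U i l -
      pureState x U p p * (1 : Matrix n n ℂ) i l) =
      Fintype.card n * pureState x U i l - (1 : Matrix n n ℂ) i l := by
    intro U
    rw [Finset.sum_sub_distrib, ← Finset.sum_mul, ← Finset.sum_mul, sum_pureState_diag]
    simp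
  simp_rw [hpt] at hsum
  rw [integral_sub (integrable_unitaryHaar (by fun_prop)) (integrable_const _),
    integral_const_mul, integral_const] at hsum
  rw [eq_div_iff hcard]
  simp only [probReal_univ, one_smul] at hsum
  linear_combination hsum

/-- The second moment of a random pure state. -/
theorem integral_pureState_mul (x i l j m : n) :
    ∫ U, pureState x U i l * pureState x U j m ∂(unitaryHaar n) =
      ((1 : Matrix n n ℂ) i l * (1 : Matrix n n ℂ) j m +
        (1 : Matrix n n ℂ) i m * (1 : Matrix n n ℂ) j l) /
      (Fintype.card n * (Fintype.card n + 1)) := by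
  have hder : ∀ p, ∫ U, (((1 : Matrix n n ℂ) p p * pureState x U i l -
        pureState x U p p * (1 : Matrix n n ℂ) i l) * pureState x U j m +
      pureState x U p l * ((1 : Matrix n n ℂ) j p * pureState x U i m -
        pureState x U j p * (1 : Matrix n n ℂ) i m)) ∂(unitaryHaar n) = 0 := by
    intro p
    simpa only [single_commutator_apply] using! integral_orbit_derivation (Matrix.single x x 1)
      (F := fun R => R p l * R j m) (D := fun R Y => Y p l * R j m + R p l * Y j m)
      (by fun_prop) (fun X => by fun_prop) (fun R X Y c => by simp; ring)
      (fun γ γ' t h => (h p l).mul (h j m)) (Matrix.single p i 1)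
  have hcard : (Fintype.card n : ℂ) ≠ 0 := by
    have : Nonempty n := ⟨x⟩
    exact_mod_cast Fintype.card_ne_zero
  have hcard1 : (Fintype.card n + 1 : ℂ) ≠ 0 := Nat.cast_add_one_ne_zero _
  have hsum := Finset.sum_eq_zero fun p (_ : p ∈ Finset.univ) => hder p
  rw [← integral_finsetSum _ fun p _ => integrable_unitaryHaar (by fun_prop)] at hsum
  have hpt : ∀ U : Matrix.unitaryGroup n ℂ,
      ∑ p, (((1 : Matrix n n ℂ) p p * pureState x U i l -
        pureState x U p p * (1 : Matrix n n ℂ) i l) * pureState x U j m +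
      pureState x U p l * ((1 : Matrix n n ℂ) j p * pureState x U i m -
        pureState x U j p * (1 : Matrix n n ℂ) i m)) =
      (Fintype.card n + 1) * (pureState x U i l * pureState x U j m) -
        ((1 : Matrix n n ℂ) i l * pureState x U j m +
          (1 : Matrix n n ℂ) i m * pureState x U j l) := by
    intro U
    have h1 := sum_pureState_diag x U
    have h2 := sum_pureState_mul x U j l
    have h3 : ∑ p, pureState x U p l * (1 : Matrix n n ℂ) j p = pureState x U j l := by
      simp [Matrix.one_apply]
    have h4 := pureState_mul_swap x U i m j l
    have h5 : ∑ p : n, (1 : Matrix n n ℂ) p p = Fintype.card n := by simp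
    have : ∀ p, (((1 : Matrix n n ℂ) p p * pureState x U i l -
        pureState x U p p * (1 : Matrix n n ℂ) i l) * pureState x U j m +
      pureState x U p l * ((1 : Matrix n n ℂ) j p * pureState x U i m -
        pureState x U j p * (1 : Matrix n n ℂ) i m)) =
      (1 : Matrix n n ℂ) p p * (pureState x U i l * pureState x U j m) -
      pureState x U p p * ((1 : Matrix n n ℂ) i l * pureState x U j m) +
      (pureState x U p l * (1 : Matrix n n ℂ) j p) * pureState x U i m -
      (pureState x U p l * pureState x U j p) * (1 : Matrix n n ℂ) i m := fun p => by ring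
    simp_rw [this, Finset.sum_sub_distrib, Finset.sum_add_distrib, Finset.sum_sub_distrib,
      ← Finset.sum_mul, h1, h2, h3, h5]
    linear_combination h4
  simp_rw [hpt] at hsum
  rw [integral_sub (integrable_unitaryHaar (by fun_prop)) (integrable_unitaryHaar (by fun_prop)),
    integral_const_mul, integral_add (integrable_unitaryHaar (by fun_prop))
      (integrable_unitaryHaar (by fun_prop)), integral_const_mul, integral_const_mul,
    integral_pureState, integral_pureState] at hsum
  field_simp at hsum ⊢
  linear_combination hsum

/-- The third moment of a random pure state: up to normalization, the sum of the six permutations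
of three tensor factors. -/
theorem integral_pureState_mul_mul (x i l j m k q : n) :
    ∫ U, pureState x U i l * pureState x U j m * pureState x U k q ∂(unitaryHaar n) =
      ((1 : Matrix n n ℂ) i l * ((1 : Matrix n n ℂ) j m * (1 : Matrix n n ℂ) k q +
          (1 : Matrix n n ℂ) j q * (1 : Matrix n n ℂ) k m) +
        (1 : Matrix n n ℂ) i m * ((1 : Matrix n n ℂ) j l * (1 : Matrix n n ℂ) k q +
          (1 : Matrix n n ℂ) j q * (1 : Matrix n n ℂ) k l) +
        (1 : Matrix n n ℂ) i q * ((1 : Matrix n n ℂ) k l * (1 : Matrix n n ℂ) j m +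
          (1 : Matrix n n ℂ) k m * (1 : Matrix n n ℂ) j l)) /
      (Fintype.card n * (Fintype.card n + 1) * (Fintype.card n + 2)) := by
  have hder : ∀ p, ∫ U, (((1 : Matrix n n ℂ) p p * pureState x U i l -
        pureState x U p p * (1 : Matrix n n ℂ) i l) * pureState x U j m * pureState x U k q +
      pureState x U p l * ((1 : Matrix n n ℂ) j p * pureState x U i m -
        pureState x U j p * (1 : Matrix n n ℂ) i m) * pureState x U k q +
      pureState x U p l * pureState x U j m * ((1 : Matrix n n ℂ) k p * pureState x U i q -
        pureState x U k p * (1 : Matrix n n ℂ) i q)) ∂(unitaryHaar n) = 0 := by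
    intro p
    simpa only [single_commutator_apply] using! integral_orbit_derivation (Matrix.single x x 1)
      (F := fun R => R p l * R j m * R k q)
      (D := fun R Y => Y p l * R j m * R k q + R p l * Y j m * R k q + R p l * R j m * Y k q)
      (by fun_prop) (fun X => by fun_prop) (fun R X Y c => by simp; ring)
      (fun γ γ' t h => (((h p l).mul (h j m)).mul (h k q)).congr_deriv
        (by simp only [Pi.mul_apply]; ring)) (Matrix.single p i 1)
  have hcard : (Fintype.card n : ℂ) ≠ 0 := by
    have : Nonempty n := ⟨x⟩
    exact_mod_cast Fintype.card_ne_zero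
  have hcard1 : (Fintype.card n + 1 : ℂ) ≠ 0 := Nat.cast_add_one_ne_zero _
  have hcard2 : (Fintype.card n + 2 : ℂ) ≠ 0 := by norm_cast
  have hsum := Finset.sum_eq_zero fun p (_ : p ∈ Finset.univ) => hder p
  rw [← integral_finsetSum _ fun p _ => integrable_unitaryHaar (by fun_prop)] at hsum
  have hpt : ∀ U : Matrix.unitaryGroup n ℂ,
      ∑ p, (((1 : Matrix n n ℂ) p p * pureState x U i l -
        pureState x U p p * (1 : Matrix n n ℂ) i l) * pureState x U j m * pureState x U k q +
      pureState x U p l * ((1 : Matrix n n ℂ) j p * pureState x U i m -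
        pureState x U j p * (1 : Matrix n n ℂ) i m) * pureState x U k q +
      pureState x U p l * pureState x U j m * ((1 : Matrix n n ℂ) k p * pureState x U i q -
        pureState x U k p * (1 : Matrix n n ℂ) i q)) =
      (Fintype.card n + 2) * (pureState x U i l * pureState x U j m * pureState x U k q) -
        ((1 : Matrix n n ℂ) i l * (pureState x U j m * pureState x U k q) +
          (1 : Matrix n n ℂ) i m * (pureState x U j l * pureState x U k q) +
          (1 : Matrix n n ℂ) i q * (pureState x U k l * pureState x U j m)) := by
    intro U
    have h1 := sum_pureState_diag x U
    have h2 := sum_pureState_mul x U j l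
    have h3 : ∀ j, ∑ p, pureState x U p l * (1 : Matrix n n ℂ) j p = pureState x U j l := by
      simp [Matrix.one_apply]
    have h4 := pureState_mul_swap x U i m j l
    have h5 : ∑ p : n, (1 : Matrix n n ℂ) p p = Fintype.card n := by simp
    have h6 := sum_pureState_mul x U k l
    have h7 := pureState_mul_swap x U i q k l
    have : ∀ p, (((1 : Matrix n n ℂ) p p * pureState x U i l -
        pureState x U p p * (1 : Matrix n n ℂ) i l) * pureState x U j m * pureState x U k q +
      pureState x U p l * ((1 : Matrix n n ℂ) j p * pureState x U i m -
        pureState x U j p * (1 : Matrix n n ℂ) i m) * pureState x U k q +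
      pureState x U p l * pureState x U j m * ((1 : Matrix n n ℂ) k p * pureState x U i q -
        pureState x U k p * (1 : Matrix n n ℂ) i q)) =
      (1 : Matrix n n ℂ) p p * (pureState x U i l * pureState x U j m * pureState x U k q) -
      pureState x U p p * ((1 : Matrix n n ℂ) i l * pureState x U j m * pureState x U k q) +
      (pureState x U p l * (1 : Matrix n n ℂ) j p) * (pureState x U i m * pureState x U k q) -
      (pureState x U p l * pureState x U j p) * ((1 : Matrix n n ℂ) i m * pureState x U k q) +
      (pureState x U p l * (1 : Matrix n n ℂ) k p) * (pureState x U i q * pureState x U j m) -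
      (pureState x U p l * pureState x U k p) * ((1 : Matrix n n ℂ) i q * pureState x U j m) :=
      fun p => by ring
    simp_rw [this, Finset.sum_sub_distrib, Finset.sum_add_distrib, Finset.sum_sub_distrib,
      Finset.sum_add_distrib, Finset.sum_sub_distrib, ← Finset.sum_mul, h1, h2, h3, h5, h6]
    linear_combination pureState x U k q * h4 + pureState x U j m * h7
  simp_rw [hpt] at hsum
  rw [integral_sub (integrable_unitaryHaar (by fun_prop)) (integrable_unitaryHaar (by fun_prop)),
    integral_const_mul, integral_add (integrable_unitaryHaar (by fun_prop))
      (integrable_unitaryHaar (by fun_prop)), integral_add (integrable_unitaryHaar (by fun_prop))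
      (integrable_unitaryHaar (by fun_prop)), integral_const_mul, integral_const_mul,
    integral_const_mul, integral_pureState_mul, integral_pureState_mul,
    integral_pureState_mul] at hsum
  field_simp at hsum ⊢
  linear_combination hsum

end Moments

/-! ### Partial traces -/

section PartialTrace

set_option linter.unusedSectionVars false

variable {A B : Type*} [Fintype A] [Fintype B]

theorem trace_marginalA (ρ : Matrix (A × B) (A × B) ℂ) : (marginalA ρ).trace = ρ.trace := by
  simp [Matrix.trace, marginalA, Fintype.sum_prod_type]

theorem trace_marginalB (ρ : Matrix (A × B) (A × B) ℂ) : (marginalB ρ).trace = ρ.trace := by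
  simp [Matrix.trace, marginalB, Fintype.sum_prod_type_right]

theorem marginalA_sum_smul {ι : Type*} (s : Finset ι) (c : ι → ℂ)
    (Y : ι → Matrix (A × B) (A × B) ℂ) :
    marginalA (∑ i ∈ s, c i • Y i) = ∑ i ∈ s, c i • marginalA (Y i) := by
  ext a a'
  simp only [marginalA, Matrix.of_apply, Matrix.sum_apply, Matrix.smul_apply, Finset.smul_sum]
  exact Finset.sum_comm

theorem marginalB_sum_smul {ι : Type*} (s : Finset ι) (c : ι → ℂ)
    (Y : ι → Matrix (A × B) (A × B) ℂ) :
    marginalB (∑ i ∈ s, c i • Y i) = ∑ i ∈ s, c i • marginalB (Y i) := by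
  ext a a'
  simp only [marginalB, Matrix.of_apply, Matrix.sum_apply, Matrix.smul_apply, Finset.smul_sum]
  exact Finset.sum_comm

@[fun_prop]
theorem continuous_marginalA :
    Continuous (marginalA : Matrix (A × B) (A × B) ℂ → Matrix A A ℂ) := by
  refine continuous_matrix fun a a' => ?_
  simp only [marginalA, Matrix.of_apply]
  fun_prop

@[fun_prop]
theorem continuous_marginalB :
    Continuous (marginalB : Matrix (A × B) (A × B) ℂ → Matrix B B ℂ) := by
  refine continuous_matrix fun b b' => ?_
  simp only [marginalB, Matrix.of_apply]
  fun_prop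

@[fun_prop]
theorem continuous_marginal_kronecker {X : Type*} [TopologicalSpace X]
    {Y Z : X → Matrix (A × B) (A × B) ℂ} (hY : Continuous Y) (hZ : Continuous Z) :
    Continuous fun x => marginalA (Y x) ⊗ₖ marginalB (Z x) := by
  refine continuous_matrix fun i j => ?_
  simp only [Matrix.kroneckerMap_apply]
  exact ((continuous_marginalA.comp hY).matrix_elem _ _).mul
    ((continuous_marginalB.comp hZ).matrix_elem _ _)

@[fun_prop]
theorem continuous_marginalProduct :
    Continuous (marginalProduct : Matrix (A × B) (A × B) ℂ → Matrix (A × B) (A × B) ℂ) :=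
  continuous_marginal_kronecker continuous_id continuous_id

/-- The trace is written as a single sum over three pairs, so that the moment formulas apply to it
termwise. -/
theorem trace_mul_kronecker_marginal (X Y Z : Matrix (A × B) (A × B) ℂ) :
    (X * (marginalA Y ⊗ₖ marginalB Z)).trace =
      ∑ p : (A × B) × (A × B) × (A × B), X p.1 p.2.1 *
        Y (p.2.1.1, p.2.2.2) (p.1.1, p.2.2.2) * Z (p.2.2.1, p.2.1.2) (p.2.2.1, p.1.2) := by
  simp only [Matrix.trace, Matrix.diag, Matrix.mul_apply, Matrix.kroneckerMap_apply, marginalA,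
    marginalB, Matrix.of_apply, Fintype.sum_prod_type (α₁ := A × B)]
  refine Finset.sum_congr rfl fun x _ => Finset.sum_congr rfl fun y _ => ?_
  rw [Finset.sum_mul_sum, Finset.mul_sum, Fintype.sum_prod_type, Finset.sum_comm]
  simp only [Finset.mul_sum, mul_assoc]

theorem trace_marginalA_mul (X Y : Matrix (A × B) (A × B) ℂ) :
    (marginalA X * marginalA Y).trace =
      ∑ p : (A × B) × (A × B), X (p.1.1, p.1.2) (p.2.1, p.1.2) *
        Y (p.2.1, p.2.2) (p.1.1, p.2.2) := by
  simp only [Matrix.trace, Matrix.diag, Matrix.mul_apply, marginalA, Matrix.of_apply,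
    Fintype.sum_prod_type, Finset.sum_mul_sum]
  exact Finset.sum_congr rfl fun x _ => Finset.sum_comm

theorem trace_marginalB_mul (X Y : Matrix (A × B) (A × B) ℂ) :
    (marginalB X * marginalB Y).trace =
      ∑ p : (B × A) × (B × A), X (p.1.2, p.1.1) (p.1.2, p.2.1) *
        Y (p.2.2, p.2.1) (p.2.2, p.1.1) := by
  simp only [Matrix.trace, Matrix.diag, Matrix.mul_apply, marginalB, Matrix.of_apply,
    Fintype.sum_prod_type, Finset.sum_mul_sum]
  exact Finset.sum_congr rfl fun x _ => Finset.sum_comm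

variable [DecidableEq A] [DecidableEq B]

theorem marginalA_one :
    marginalA (1 : Matrix (A × B) (A × B) ℂ) = (Fintype.card B : ℂ) • (1 : Matrix A A ℂ) := by
  ext a a'
  by_cases h : a = a' <;> simp [marginalA, Matrix.one_apply, h]

theorem marginalB_one :
    marginalB (1 : Matrix (A × B) (A × B) ℂ) = (Fintype.card A : ℂ) • (1 : Matrix B B ℂ) := by
  ext a a'
  by_cases h : a = a' <;> simp [marginalB, Matrix.one_apply, h]

theorem trace_mul_kronecker_one (X : Matrix (A × B) (A × B) ℂ) (M : Matrix A A ℂ) :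
    (X * (M ⊗ₖ (1 : Matrix B B ℂ))).trace = (marginalA X * M).trace := by
  simp only [Matrix.trace, Matrix.diag, Matrix.mul_apply, Matrix.kroneckerMap_apply, marginalA,
    Matrix.of_apply, Fintype.sum_prod_type, Matrix.one_apply, mul_ite, mul_one, mul_zero,
    Finset.sum_ite_eq', Finset.mem_univ, if_true, Finset.sum_mul]
  exact Finset.sum_congr rfl fun x _ => Finset.sum_comm

theorem trace_mul_one_kronecker (X : Matrix (A × B) (A × B) ℂ) (M : Matrix B B ℂ) :
    (X * ((1 : Matrix A A ℂ) ⊗ₖ M)).trace = (marginalB X * M).trace := by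
  simp only [Matrix.trace, Matrix.diag, Matrix.mul_apply, Matrix.kroneckerMap_apply, marginalB,
    Matrix.of_apply, Fintype.sum_prod_type, Matrix.one_apply, ite_mul, one_mul, zero_mul, mul_ite,
    mul_zero, Finset.sum_mul]
  rw [Finset.sum_comm]
  refine Finset.sum_congr rfl fun b _ => ?_
  conv_rhs => rw [Finset.sum_comm]
  refine Finset.sum_congr rfl fun a _ => ?_
  rw [Finset.sum_comm]
  simp

end PartialTrace

/-! ### Moments of the marginals of a random pure state -/

section MarginalMoments

variable {A B : Type*} [Fintype A] [Fintype B] [DecidableEq A] [DecidableEq B]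

/-- The average purity of the `A`-marginal of a random pure state. -/
theorem integral_trace_marginalA_sq (x : A × B) :
    ∫ U, (marginalA (pureState x U) * marginalA (pureState x U)).trace ∂(unitaryHaar (A × B)) =
      (Fintype.card A + Fintype.card B) / (Fintype.card A * Fintype.card B + 1) := by
  have hA : (Fintype.card A : ℂ) ≠ 0 := by
    have : Nonempty A := ⟨x.1⟩
    exact_mod_cast Fintype.card_ne_zero
  have hB : (Fintype.card B : ℂ) ≠ 0 := by
    have : Nonempty B := ⟨x.2⟩
    exact_mod_cast Fintype.card_ne_zero
  have hd : (Fintype.card A * Fintype.card B + 1 : ℂ) ≠ 0 := by norm_cast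
  simp_rw [trace_marginalA_mul]
  rw [integral_finsetSum _ fun p _ => integrable_unitaryHaar (by fun_prop)]
  simp_rw [integral_pureState_mul, ← Finset.sum_div, Fintype.sum_prod_type, Finset.sum_add_distrib,
    Matrix.one_apply]
  simp
  field_simp
  ring

/-- The average purity of the `B`-marginal of a random pure state. -/
theorem integral_trace_marginalB_sq (x : A × B) :
    ∫ U, (marginalB (pureState x U) * marginalB (pureState x U)).trace ∂(unitaryHaar (A × B)) =
      (Fintype.card A + Fintype.card B) / (Fintype.card A * Fintype.card B + 1) := by
  have hA : (Fintype.card A : ℂ) ≠ 0 := by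
    have : Nonempty A := ⟨x.1⟩
    exact_mod_cast Fintype.card_ne_zero
  have hB : (Fintype.card B : ℂ) ≠ 0 := by
    have : Nonempty B := ⟨x.2⟩
    exact_mod_cast Fintype.card_ne_zero
  have hd : (Fintype.card A * Fintype.card B + 1 : ℂ) ≠ 0 := by norm_cast
  simp_rw [trace_marginalB_mul]
  rw [integral_finsetSum _ fun p _ => integrable_unitaryHaar (by fun_prop)]
  simp_rw [integral_pureState_mul, ← Finset.sum_div, Fintype.sum_prod_type, Finset.sum_add_distrib,
    Matrix.one_apply]
  simp
  field_simp

theorem integral_trace_pureState_mul_marginalProduct (x : A × B) :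
    ∫ U, (pureState x U * (marginalA (pureState x U) ⊗ₖ marginalB (pureState x U))).trace
      ∂(unitaryHaar (A × B)) =
      (3 * (Fintype.card A * Fintype.card B) + Fintype.card A ^ 2 + Fintype.card B ^ 2 + 1) /
        ((Fintype.card A * Fintype.card B + 1) * (Fintype.card A * Fintype.card B + 2)) := by
  have hA : (Fintype.card A : ℂ) ≠ 0 := by
    have : Nonempty A := ⟨x.1⟩
    exact_mod_cast Fintype.card_ne_zero
  have hB : (Fintype.card B : ℂ) ≠ 0 := by
    have : Nonempty B := ⟨x.2⟩
    exact_mod_cast Fintype.card_ne_zero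
  have hd : (Fintype.card A * Fintype.card B + 1 : ℂ) ≠ 0 := by norm_cast
  have hd' : (Fintype.card A * Fintype.card B + 2 : ℂ) ≠ 0 := by norm_cast
  simp_rw [trace_mul_kronecker_marginal]
  rw [integral_finsetSum _ fun p _ => integrable_unitaryHaar (by fun_prop)]
  simp_rw [integral_pureState_mul_mul, ← Finset.sum_div, Fintype.sum_prod_type, mul_add,
    Finset.sum_add_distrib, Matrix.one_apply]
  simp [ite_and]
  field_simp
  ring

end MarginalMoments

/-! ### The averaged product of marginals -/

section ColumnSymmetry

variable {n : Type*} [Fintype n] [DecidableEq n]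

/-- The unitary matrix permuting the basis vectors by `π`. -/
def permUnitary (π : Equiv.Perm n) : Matrix.unitaryGroup n ℂ :=
  ⟨(π⁻¹).permMatrix ℂ, by
    rw [Matrix.mem_unitaryGroup_iff, Matrix.star_eq_conjTranspose, Matrix.conjTranspose_permMatrix,
      ← Matrix.permMatrix_mul]
    simp⟩

theorem pureState_mul_permUnitary (π : Equiv.Perm n) (x : n) (U : Matrix.unitaryGroup n ℂ) :
    pureState x (U * permUnitary π) = pureState (π x) U := by
  have h : ∀ i, ((U * permUnitary π : Matrix.unitaryGroup n ℂ) : Matrix n n ℂ) i x =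
      (U : Matrix n n ℂ) i (π x) := by
    intro i
    simp [permUnitary, Matrix.mul_apply, Equiv.Perm.permMatrix, PEquiv.toMatrix_apply,
      Equiv.symm_apply_eq]
  ext i j
  rw [pureState_apply, pureState_apply, h, h]

theorem sum_pureState (U : Matrix.unitaryGroup n ℂ) : ∑ x, pureState x U = 1 := by
  ext i j
  rw [← Unitary.coe_mul_star_self U, Matrix.sum_apply, Matrix.mul_apply]
  simp only [pureState_apply, Unitary.coe_star, Matrix.star_apply]

theorem orbit_diagonal (D : n → ℂ) (U : Matrix.unitaryGroup n ℂ) :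
    orbit (Matrix.diagonal D) U = ∑ x, D x • pureState x U := by
  ext i j
  rw [orbit, Matrix.mul_apply]
  simp only [Matrix.sum_apply, Matrix.smul_apply, pureState_apply, Matrix.mul_diagonal,
    Matrix.star_apply, smul_eq_mul]
  exact Finset.sum_congr rfl fun x _ => by ring

theorem trace_pureState (x : n) (U : Matrix.unitaryGroup n ℂ) : (pureState x U).trace = 1 :=
  sum_pureState_diag x U

theorem trace_pureState_mul (x : n) (U : Matrix.unitaryGroup n ℂ) (M : Matrix n n ℂ) :
    (pureState x U * M).trace = (star (U : Matrix n n ℂ) * M * (U : Matrix n n ℂ)) x x := by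
  simp only [Matrix.trace, Matrix.diag, Matrix.mul_apply, pureState_apply, Matrix.star_apply,
    Finset.sum_mul]
  exact Finset.sum_congr rfl fun i _ => Finset.sum_congr rfl fun j _ => by ring

theorem sum_eq_add_card_sub_one_mul {f : n → ℂ} {i j : n}
    (hf : ∀ k, k ≠ i → f k = f j) : ∑ k, f k = f i + (Fintype.card n - 1) * f j := by
  rw [← Finset.add_sum_erase _ _ (Finset.mem_univ i),
    Finset.sum_congr rfl fun k hk => hf k (Finset.ne_of_mem_erase hk), Finset.sum_const,
    Finset.card_erase_of_mem (Finset.mem_univ i), Finset.card_univ, nsmul_eq_mul,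
    Nat.cast_sub (Fintype.card_pos_iff.2 ⟨i⟩)]
  simp

theorem sum_eq_add_add_card_sub_two_mul {f : n → ℂ} {i j k : n}
    (hjk : j ≠ k) (hf : ∀ l, l ≠ j → l ≠ k → f l = f i) :
    ∑ l, f l = f j + f k + (Fintype.card n - 2) * f i := by
  rw [← Finset.add_sum_erase _ _ (Finset.mem_univ j),
    ← Finset.add_sum_erase _ _ (Finset.mem_erase.2 ⟨hjk.symm, Finset.mem_univ k⟩)]
  rw [Finset.sum_congr rfl fun l hl => hf l (Finset.ne_of_mem_erase (Finset.mem_of_mem_erase hl))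
      (Finset.ne_of_mem_erase hl), Finset.sum_const,
    Finset.card_erase_of_mem (Finset.mem_erase.2 ⟨hjk.symm, Finset.mem_univ k⟩),
    Finset.card_erase_of_mem (Finset.mem_univ j), Finset.card_univ, nsmul_eq_mul]
  have h2 : 2 ≤ Fintype.card n := Fintype.one_lt_card_iff.2 ⟨j, k, hjk⟩
  rw [Nat.sub_sub, Nat.cast_sub h2]
  push_cast
  ring

end ColumnSymmetry

section ColumnMoment

variable {A B : Type*} [Fintype A] [Fintype B] [DecidableEq A] [DecidableEq B]

/-- The average overlap of the pure state `U |i⟩` with the product of the `A`-marginal of `U |j⟩`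
and the `B`-marginal of `U |k⟩`. -/
def columnMoment (i j k : A × B) : ℂ :=
  ∫ U, (pureState i U * (marginalA (pureState j U) ⊗ₖ marginalB (pureState k U))).trace
    ∂(unitaryHaar (A × B))

theorem integrable_columnMoment (i j k : A × B) : Integrable (fun U => (pureState i U *
    (marginalA (pureState j U) ⊗ₖ marginalB (pureState k U))).trace) (unitaryHaar (A × B)) :=
  integrable_unitaryHaar (by fun_prop)

theorem columnMoment_perm (π : Equiv.Perm (A × B)) (i j k : A × B) :
    columnMoment (π i) (π j) (π k) = columnMoment i j k := by
  unfold columnMoment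
  simp_rw [← pureState_mul_permUnitary]
  exact integral_mul_right_eq_self (fun U => (pureState i U *
    (marginalA (pureState j U) ⊗ₖ marginalB (pureState k U))).trace) (permUnitary π)

theorem sum_columnMoment_fst (j k : A × B) : ∑ i, columnMoment i j k = 1 := by
  unfold columnMoment
  rw [← integral_finsetSum _ fun i _ => integrable_columnMoment i j k]
  simp_rw [← Matrix.trace_sum, ← Finset.sum_mul, sum_pureState, one_mul, Matrix.trace_kronecker,
    trace_marginalA, trace_marginalB, trace_pureState]
  simp

theorem sum_columnMoment_snd (i : A × B) : ∑ j, columnMoment i j i =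
    Fintype.card B * ((Fintype.card A + Fintype.card B) /
      (Fintype.card A * Fintype.card B + 1)) := by
  have hsum : ∀ U : Matrix.unitaryGroup (A × B) ℂ, ∑ j, marginalA (pureState j U) = (Fintype.card B : ℂ) • (1 : Matrix A A ℂ) := by
    intro U
    have := marginalA_sum_smul Finset.univ (fun _ : A × B => (1 : ℂ)) fun j => pureState j U
    simpa only [one_smul, sum_pureState, marginalA_one] using this.symm
  have hk : ∀ U : Matrix.unitaryGroup (A × B) ℂ, ∑ j, marginalA (pureState j U) ⊗ₖ marginalB (pureState i U) =
      (Fintype.card B : ℂ) • ((1 : Matrix A A ℂ) ⊗ₖ marginalB (pureState i U)) := by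
    intro U
    rw [← Matrix.smul_kronecker, ← hsum U]
    ext p q
    simp [Matrix.sum_apply, Finset.sum_mul]
  unfold columnMoment
  rw [← integral_finsetSum _ fun j _ => integrable_columnMoment i j i]
  simp_rw [← Matrix.trace_sum, ← Finset.mul_sum, hk, Matrix.mul_smul, Matrix.trace_smul,
    trace_mul_one_kronecker, smul_eq_mul]
  rw [integral_const_mul, integral_trace_marginalB_sq]

theorem sum_columnMoment_trd (i : A × B) : ∑ k, columnMoment i i k =
    Fintype.card A * ((Fintype.card A + Fintype.card B) /
      (Fintype.card A * Fintype.card B + 1)) := by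
  have hsum : ∀ U : Matrix.unitaryGroup (A × B) ℂ, ∑ j, marginalB (pureState j U) = (Fintype.card A : ℂ) • (1 : Matrix B B ℂ) := by
    intro U
    have := marginalB_sum_smul Finset.univ (fun _ : A × B => (1 : ℂ)) fun j => pureState j U
    simpa only [one_smul, sum_pureState, marginalB_one] using this.symm
  have hk : ∀ U : Matrix.unitaryGroup (A × B) ℂ, ∑ j, marginalA (pureState i U) ⊗ₖ marginalB (pureState j U) =
      (Fintype.card A : ℂ) • (marginalA (pureState i U) ⊗ₖ (1 : Matrix B B ℂ)) := by
    intro U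
    rw [← Matrix.kronecker_smul, ← hsum U]
    ext p q
    simp [Matrix.sum_apply, Finset.mul_sum]
  unfold columnMoment
  rw [← integral_finsetSum _ fun j _ => integrable_columnMoment i i j]
  simp_rw [← Matrix.trace_sum, ← Finset.mul_sum, hk, Matrix.mul_smul, Matrix.trace_smul,
    trace_mul_kronecker_one, smul_eq_mul]
  rw [integral_const_mul, integral_trace_marginalA_sq]

/-- The column moments take five values: `t₁` if all indices agree, `t₂` if only the last two
agree, `tA` if only the first two agree, `tB` if only the first and the last agree, and `t₃` if no
two agree. The values follow from `t₁` and from the sums over one index. -/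
theorem columnMoment_eq (hd : 2 < Fintype.card A * Fintype.card B) (i j k : A × B)
    {a b d t₁ t₂ tA tB t₃ : ℂ} (ha : a = Fintype.card A) (hb : b = Fintype.card B) (hdab : d = a * b)
    (h₁ : t₁ = (3 * d + a ^ 2 + b ^ 2 + 1) / ((d + 1) * (d + 2)))
    (h₂ : t₂ = (1 - t₁) / (d - 1))
    (hA : tA = (a * ((a + b) / (d + 1)) - t₁) / (d - 1))
    (hB : tB = (b * ((a + b) / (d + 1)) - t₁) / (d - 1))
    (h₃ : t₃ = (1 - tA - tB) / (d - 2)) :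
    columnMoment i j k = t₃ + (t₂ - t₃) * (1 : Matrix (A × B) (A × B) ℂ) j k +
      (tA - t₃) * (1 : Matrix (A × B) (A × B) ℂ) i j +
      (tB - t₃) * (1 : Matrix (A × B) (A × B) ℂ) i k +
      (t₁ - tA - tB - t₂ + 2 * t₃) * ((1 : Matrix (A × B) (A × B) ℂ) i j *
        (1 : Matrix (A × B) (A × B) ℂ) i k) := by
  have hcard : (Fintype.card (A × B) : ℂ) = d := by
    rw [hdab, ha, hb, Fintype.card_prod, Nat.cast_mul]
  have hd1 : d - 1 ≠ 0 := by
    rw [hdab, ha, hb, sub_ne_zero]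
    exact_mod_cast (by omega : Fintype.card A * Fintype.card B ≠ 1)
  have hd2 : d - 2 ≠ 0 := by
    rw [hdab, ha, hb, sub_ne_zero]
    exact_mod_cast (by omega : Fintype.card A * Fintype.card B ≠ 2)
  have case1 : ∀ i : A × B, columnMoment i i i = t₁ := by
    intro i
    rw [h₁, hdab, ha, hb]
    exact integral_trace_pureState_mul_marginalProduct i
  -- exchanging two columns shows that a moment only depends on which of its indices coincide
  have hswap : ∀ p q i j k : A × B, columnMoment (Equiv.swap p q i) (Equiv.swap p q j)
      (Equiv.swap p q k) = columnMoment i j k := fun p q => columnMoment_perm _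
  have case2 : ∀ i j : A × B, i ≠ j → columnMoment i j j = t₂ := by
    intro i j hij
    have h := sum_eq_add_card_sub_one_mul (f := fun l => columnMoment l j j) (i := j) (j := i)
      fun l hl => by
        simpa [Equiv.swap_apply_of_ne_of_ne hl.symm hij.symm] using hswap l i i j j
    rw [sum_columnMoment_fst, hcard, case1] at h
    rw [h₂, eq_div_iff hd1]
    linear_combination -h
  have caseA : ∀ i k : A × B, i ≠ k → columnMoment i i k = tA := by
    intro i k hik
    have h := sum_eq_add_card_sub_one_mul (f := fun l => columnMoment i i l) (i := i) (j := k)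
      fun l hl => by
        simpa [Equiv.swap_apply_of_ne_of_ne hl.symm hik] using hswap l k i i k
    rw [sum_columnMoment_trd, hcard, case1, ← ha, ← hb, ← hdab] at h
    rw [hA, eq_div_iff hd1]
    linear_combination -h
  have caseB : ∀ i j : A × B, i ≠ j → columnMoment i j i = tB := by
    intro i k hik
    have h := sum_eq_add_card_sub_one_mul (f := fun l => columnMoment i l i) (i := i) (j := k)
      fun l hl => by
        simpa [Equiv.swap_apply_of_ne_of_ne hl.symm hik] using hswap l k i k i
    rw [sum_columnMoment_snd, hcard, case1, ← ha, ← hb, ← hdab] at h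
    rw [hB, eq_div_iff hd1]
    linear_combination -h
  have case3 : ∀ i j k : A × B, i ≠ j → i ≠ k → j ≠ k → columnMoment i j k = t₃ := by
    intro i j k hij hik hjk
    have h := sum_eq_add_add_card_sub_two_mul (f := fun l => columnMoment l j k) (i := i) hjk
      fun l hl hl' => by
        simpa [Equiv.swap_apply_of_ne_of_ne hl.symm hij.symm,
          Equiv.swap_apply_of_ne_of_ne hl'.symm hik.symm] using hswap l i i j k
    rw [sum_columnMoment_fst, hcard, caseA j k hjk, caseB k j hjk.symm] at h
    rw [h₃, eq_div_iff hd2]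
    linear_combination -h
  by_cases hij : i = j
  · subst hij
    by_cases hik : i = k
    · subst hik
      rw [case1]
      simp
      ring
    · rw [caseA i k hik]
      simp [hik]
  · by_cases hik : i = k
    · subst hik
      rw [caseB i j hij]
      simp [hij, Ne.symm hij]
    · by_cases hjk : j = k
      · subst hjk
        rw [case2 i j hij]
        simp [hij]
      · rw [case3 i j k hij hik hjk]
        simp [hij, hik, hjk]

/-- The diagonal entries of the averaged product of marginals for a diagonal matrix of trace one. -/
theorem sum_columnMoment (hd : 2 < Fintype.card A * Fintype.card B) (D : A × B → ℂ)
    (hD : ∑ i, D i = 1) (P : ℝ) (hP : ∑ i, D i ^ 2 = P) (i : A × B) :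
    ∑ j, ∑ k, D j * D k * columnMoment i j k =
      c₀ (Fintype.card A) (Fintype.card B) P + c₁ (Fintype.card A) (Fintype.card B) * D i +
        c₂ (Fintype.card A) (Fintype.card B) * D i ^ 2 := by
  obtain ⟨a, ha⟩ : ∃ a : ℂ, a = Fintype.card A := ⟨_, rfl⟩
  obtain ⟨b, hb⟩ : ∃ b : ℂ, b = Fintype.card B := ⟨_, rfl⟩
  have hd1 : a * b - 1 ≠ 0 := by
    rw [ha, hb, sub_ne_zero]
    exact_mod_cast (by omega : Fintype.card A * Fintype.card B ≠ 1)
  have hd2 : a * b - 2 ≠ 0 := by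
    rw [ha, hb, sub_ne_zero]
    exact_mod_cast (by omega : Fintype.card A * Fintype.card B ≠ 2)
  have hd3 : a * b + 1 ≠ 0 := by rw [ha, hb]; norm_cast
  have hd4 : a * b + 2 ≠ 0 := by rw [ha, hb]; norm_cast
  have hsum : ∀ e e₁ e₂ e₃ e₄ : ℂ, ∑ j, ∑ k, D j * D k *
      (e + e₁ * (1 : Matrix (A × B) (A × B) ℂ) j k + e₂ * (1 : Matrix (A × B) (A × B) ℂ) i j +
        e₃ * (1 : Matrix (A × B) (A × B) ℂ) i k + e₄ * ((1 : Matrix (A × B) (A × B) ℂ) i j *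
        (1 : Matrix (A × B) (A × B) ℂ) i k)) =
      e + e₁ * P + (e₂ + e₃) * D i + e₄ * D i ^ 2 := by
    intro e e₁ e₂ e₃ e₄
    have hs1 : ∑ j, ∑ k, D j * D k * e = e := by
      simp_rw [← Finset.sum_mul, ← Finset.mul_sum, hD]
      simp [hD]
    have hs2 : ∑ j, ∑ k, D j * D k * (e₁ * (1 : Matrix (A × B) (A × B) ℂ) j k) = e₁ * P := by
      rw [← hP, Finset.mul_sum]
      refine Finset.sum_congr rfl fun j _ => ?_
      simp [Matrix.one_apply]
      ring
    have hs3 : ∑ j, ∑ k, D j * D k * (e₂ * (1 : Matrix (A × B) (A × B) ℂ) i j) = e₂ * D i := by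
      simp_rw [← Finset.sum_mul, ← Finset.mul_sum, hD]
      simp [Matrix.one_apply]
      ring
    have hs4 : ∑ j, ∑ k, D j * D k * (e₃ * (1 : Matrix (A × B) (A × B) ℂ) i k) = e₃ * D i := by
      simp_rw [mul_assoc, ← Finset.mul_sum, ← Finset.sum_mul, hD]
      simp [Matrix.one_apply]
      ring
    have hs5 : ∑ j, ∑ k, D j * D k * (e₄ * ((1 : Matrix (A × B) (A × B) ℂ) i j *
        (1 : Matrix (A × B) (A × B) ℂ) i k)) = e₄ * D i ^ 2 := by
      simp [Matrix.one_apply]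
      ring
    simp_rw [mul_add (D _ * D _), Finset.sum_add_distrib, hs1, hs2, hs3, hs4, hs5]
    ring
  simp_rw [columnMoment_eq hd i _ _ ha hb rfl rfl rfl rfl rfl rfl, hsum, c₀, c₁, c₂]
  push_cast
  rw [← ha, ← hb]
  rw [show (a * b) ^ 2 - 1 = (a * b - 1) * (a * b + 1) by ring,
    show (a * b) ^ 2 - 4 = (a * b - 2) * (a * b + 2) by ring]
  field_simp
  ring

end ColumnMoment

section Average

variable {n : Type*} [Fintype n] [DecidableEq n]

theorem star_mul_orbit_mul (ρ : Matrix n n ℂ) (U : Matrix.unitaryGroup n ℂ) :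
    star (U : Matrix n n ℂ) * orbit ρ U * (U : Matrix n n ℂ) = ρ := by
  simp [orbit, mul_assoc, ← mul_assoc (star (U : Matrix n n ℂ)) (U : Matrix n n ℂ)]

theorem orbit_orbit (ρ : Matrix n n ℂ) (U W : Matrix.unitaryGroup n ℂ) :
    orbit (orbit ρ W) U = orbit ρ (U * W) := by
  simp [orbit, mul_assoc]

theorem orbit_mul_orbit (X Y : Matrix n n ℂ) (U : Matrix.unitaryGroup n ℂ) :
    orbit X U * orbit Y U = orbit (X * Y) U := by
  simp [orbit, mul_assoc, ← mul_assoc (star (U : Matrix n n ℂ)) (U : Matrix n n ℂ)]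

theorem orbit_add (X Y : Matrix n n ℂ) (U : Matrix.unitaryGroup n ℂ) :
    orbit (X + Y) U = orbit X U + orbit Y U := by
  simp [orbit, mul_add, add_mul]

theorem orbit_smul (c : ℂ) (X : Matrix n n ℂ) (U : Matrix.unitaryGroup n ℂ) :
    orbit (c • X) U = c • orbit X U := by
  simp [orbit]

theorem orbit_one_left (U : Matrix.unitaryGroup n ℂ) : orbit (1 : Matrix n n ℂ) U = 1 := by
  simp [orbit]

theorem exists_orbit_diagonal {ρ : Matrix n n ℂ} (hρ : ρ.IsHermitian) :
    ∃ (D : n → ℝ) (V : Matrix.unitaryGroup n ℂ),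
      ρ = orbit (Matrix.diagonal fun i => (D i : ℂ)) V :=
  ⟨hρ.eigenvalues, hρ.eigenvectorUnitary, by
    conv_lhs => rw [hρ.spectral_theorem]
    rfl⟩

open scoped Matrix.Norms.L2Operator in
theorem integral_matrix_apply {F : Matrix.unitaryGroup n ℂ → Matrix n n ℂ} (hF : Continuous F)
    (i j : n) : (∫ U, F U ∂(unitaryHaar n)) i j = ∫ U, F U i j ∂(unitaryHaar n) :=
  ((LinearMap.toContinuousLinearMap
    (Matrix.entryLinearMap ℂ ℂ i j)).integral_comp_comm (integrable_unitaryHaar hF)).symm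

variable {A B : Type*} [Fintype A] [Fintype B] [DecidableEq A] [DecidableEq B]

/-- The product of the marginals of `U ρ U†`, carried back to `ρ` by `U`. -/
def pulledProduct (ρ : Matrix (A × B) (A × B) ℂ) (U : Matrix.unitaryGroup (A × B) ℂ) :
    Matrix (A × B) (A × B) ℂ :=
  star (U : Matrix (A × B) (A × B) ℂ) * marginalProduct (orbit ρ U) *
    (U : Matrix (A × B) (A × B) ℂ)

@[fun_prop]
theorem continuous_pulledProduct (ρ : Matrix (A × B) (A × B) ℂ) :
    Continuous (pulledProduct ρ) := by
  unfold pulledProduct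
  fun_prop

theorem orbit_pulledProduct (ρ : Matrix (A × B) (A × B) ℂ) (U : Matrix.unitaryGroup (A × B) ℂ) :
    orbit (pulledProduct ρ U) U = marginalProduct (orbit ρ U) := by
  simp [orbit, pulledProduct, mul_assoc,
    ← mul_assoc (U : Matrix (A × B) (A × B) ℂ) (star (U : Matrix (A × B) (A × B) ℂ))]

theorem pulledProduct_mul (ρ : Matrix (A × B) (A × B) ℂ)
    (U W : Matrix.unitaryGroup (A × B) ℂ) :
    pulledProduct ρ (U * W) = star (W : Matrix (A × B) (A × B) ℂ) *
      pulledProduct (orbit ρ W) U * (W : Matrix (A × B) (A × B) ℂ) := by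
  simp [pulledProduct, orbit_orbit, mul_assoc]

theorem pulledProduct_diagonal_apply_self (D : A × B → ℂ) (U : Matrix.unitaryGroup (A × B) ℂ)
    (i : A × B) : pulledProduct (Matrix.diagonal D) U i i = ∑ j, ∑ k, D j * D k *
      (pureState i U * (marginalA (pureState j U) ⊗ₖ marginalB (pureState k U))).trace := by
  have hprod : marginalProduct (orbit (Matrix.diagonal D) U) =
      ∑ j, ∑ k, (D j * D k) • (marginalA (pureState j U) ⊗ₖ marginalB (pureState k U)) := by
    rw [marginalProduct, orbit_diagonal, marginalA_sum_smul, marginalB_sum_smul]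
    ext p q
    simp only [Matrix.kroneckerMap_apply, Matrix.sum_apply, Matrix.smul_apply, smul_eq_mul,
      Finset.sum_mul_sum]
    exact Finset.sum_congr rfl fun j _ => Finset.sum_congr rfl fun k _ => by ring
  rw [pulledProduct, ← trace_pureState_mul, hprod]
  simp_rw [Finset.mul_sum, Matrix.trace_sum, Matrix.mul_smul, Matrix.trace_smul, smul_eq_mul]

/-- The diagonal of the average is the quadratic form with the column moments as coefficients. -/
theorem integral_pulledProduct_diagonal_apply_self (D : A × B → ℂ) (i : A × B) :
    ∫ U, pulledProduct (Matrix.diagonal D) U i i ∂(unitaryHaar (A × B)) =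
      ∑ j, ∑ k, D j * D k * columnMoment i j k := by
  simp_rw [pulledProduct_diagonal_apply_self]
  rw [integral_finsetSum _ fun j _ => integrable_finsetSum _ fun k _ =>
    (integrable_columnMoment i j k).const_mul _]
  refine Finset.sum_congr rfl fun j _ => ?_
  rw [integral_finsetSum _ fun k _ => (integrable_columnMoment i j k).const_mul _]
  exact Finset.sum_congr rfl fun k _ => integral_const_mul _ _

/-- Off the diagonal the average vanishes, since flipping the sign of one basis vector leaves a
diagonal matrix invariant. -/
theorem integral_pulledProduct_diagonal_apply_of_ne (D : A × B → ℂ) {i j : A × B} (hij : i ≠ j) :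
    ∫ U, pulledProduct (Matrix.diagonal D) U i j ∂(unitaryHaar (A × B)) = 0 := by
  let θ : A × B → ℂ := fun k => if k = i then -1 else 1
  have hθ : ∀ k, θ k * star (θ k) = 1 := fun k => by by_cases h : k = i <;> simp [θ, h]
  have hθ' : ∀ k, star (θ k) = θ k := fun k => by by_cases h : k = i <;> simp [θ, h]
  have hdiag : (Matrix.diagonal θ : Matrix (A × B) (A × B) ℂ) * Matrix.diagonal θ = 1 := by
    rw [Matrix.diagonal_mul_diagonal, ← Matrix.diagonal_one]
    congr 1
    ext k
    rw [← hθ k, hθ']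
  have hstar : star (Matrix.diagonal θ) = Matrix.diagonal θ := by
    rw [Matrix.star_eq_conjTranspose, Matrix.diagonal_conjTranspose]
    congr 1
    ext k
    exact hθ' k
  let W : Matrix.unitaryGroup (A × B) ℂ :=
    ⟨Matrix.diagonal θ, by rw [Matrix.mem_unitaryGroup_iff, hstar, hdiag]⟩
  have hW : orbit (Matrix.diagonal D) W = Matrix.diagonal D := by
    change Matrix.diagonal θ * Matrix.diagonal D * star (Matrix.diagonal θ) = _
    rw [hstar, Matrix.diagonal_mul_diagonal, Matrix.diagonal_mul_diagonal]
    congr 1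
    ext k
    rw [mul_right_comm]
    nth_rewrite 2 [← hθ' k]
    rw [hθ, one_mul]
  have hflip : ∀ U, pulledProduct (Matrix.diagonal D) (U * W) i j =
      -pulledProduct (Matrix.diagonal D) U i j := by
    intro U
    rw [pulledProduct_mul, hW]
    change (star (Matrix.diagonal θ) * _ * Matrix.diagonal θ : Matrix (A × B) (A × B) ℂ) i j = _
    rw [hstar, Matrix.mul_diagonal, Matrix.diagonal_mul]
    simp [θ, hij.symm]
  have h := integral_mul_right_eq_self (μ := unitaryHaar (A × B))
    (fun U => pulledProduct (Matrix.diagonal D) U i j) W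
  simp_rw [hflip, integral_neg] at h
  exact self_eq_neg.1 h.symm

theorem quadraticState_orbit (ρ : Matrix (A × B) (A × B) ℂ)
    (U : Matrix.unitaryGroup (A × B) ℂ) :
    quadraticState (orbit ρ U) = orbit (quadraticState ρ) U := by
  simp only [quadraticState, orbit_add, orbit_smul, orbit_one_left, pow_two, orbit_mul_orbit,
    trace_orbit]

open scoped Matrix.Norms.L2Operator in
theorem integral_pulledProduct_diagonal (hd : 2 < Fintype.card A * Fintype.card B)
    (D : A × B → ℝ) (hD : ∑ i, D i = 1) :
    ∫ U, pulledProduct (Matrix.diagonal fun i => (D i : ℂ)) U ∂(unitaryHaar (A × B)) =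
      quadraticState (Matrix.diagonal fun i => (D i : ℂ)) := by
  ext i j
  rw [integral_matrix_apply (continuous_pulledProduct _)]
  have hpow : (Matrix.diagonal fun i => (D i : ℂ)) ^ 2 = Matrix.diagonal fun i => (D i : ℂ) ^ 2 := by
    rw [Matrix.diagonal_pow]
    rfl
  by_cases hij : i = j
  · subst hij
    rw [integral_pulledProduct_diagonal_apply_self, sum_columnMoment hd _ (by exact_mod_cast hD)
      (∑ i, D i ^ 2) (by push_cast; rfl)]
    have htr : (Matrix.diagonal fun i => (D i : ℂ) ^ 2).trace.re = ∑ i, D i ^ 2 := by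
      rw [Matrix.trace_diagonal]
      norm_cast
    rw [quadraticState, hpow, htr]
    simp
  · rw [integral_pulledProduct_diagonal_apply_of_ne _ hij]
    simp [quadraticState, hpow, hij]

open scoped Matrix.Norms.L2Operator in
/-- The Haar average of the product of marginals, carried back to `ρ`, is the quadratic
polynomial `c₀ + c₁ ρ + c₂ ρ²`. -/
theorem integral_pulledProduct (hd : 2 < Fintype.card A * Fintype.card B)
    {ρ : Matrix (A × B) (A × B) ℂ} (hρ : IsState ρ) :
    ∫ U, pulledProduct ρ U ∂(unitaryHaar (A × B)) = quadraticState ρ := by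
  obtain ⟨D, V, rfl⟩ := exists_orbit_diagonal hρ.posSemidef.isHermitian
  have hD : ∑ i, D i = 1 := by
    have := hρ.trace_eq_one
    rw [trace_orbit, Matrix.trace_diagonal] at this
    exact_mod_cast this
  have hconj : ∀ U, pulledProduct (orbit (Matrix.diagonal fun i => (D i : ℂ)) V) U =
      (V : Matrix (A × B) (A × B) ℂ) * pulledProduct (Matrix.diagonal fun i => (D i : ℂ)) (U * V) *
        star (V : Matrix (A × B) (A × B) ℂ) := by
    intro U
    rw [pulledProduct_mul]
    simp [mul_assoc, ← mul_assoc (V : Matrix (A × B) (A × B) ℂ) (star (V : Matrix _ _ ℂ))]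
  -- right invariance absorbs the eigenvector matrix `V` into the integration variable
  simp_rw [hconj]
  rw [integral_mul_const_of_integrable (integrable_unitaryHaar (by fun_prop)),
    integral_const_mul_of_integrable (integrable_unitaryHaar (by fun_prop)),
    integral_mul_right_eq_self (pulledProduct (Matrix.diagonal fun i => (D i : ℂ))) V,
    integral_pulledProduct_diagonal hd D hD, quadraticState_orbit]
  rfl

end Average

/-! ### Functional calculus in an eigenbasis -/

section EigenBasis

variable {n : Type*} [Fintype n] [DecidableEq n]

/-- The star homomorphism sending a diagonal to the matrix with this diagonal in the orthonormal
basis of the columns of `V`. -/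
def orbitDiagonalHom (V : Matrix.unitaryGroup n ℂ) : (n → ℂ) →⋆ₐ[ℂ] Matrix n n ℂ where
  toFun D := orbit (Matrix.diagonal D) V
  map_one' := by
    change orbit (Matrix.diagonal fun _ => (1 : ℂ)) V = 1
    rw [Matrix.diagonal_one, orbit_one_left]
  map_mul' D E := by
    rw [orbit_mul_orbit, Matrix.diagonal_mul_diagonal]
    rfl
  map_zero' := by
    change orbit (Matrix.diagonal fun _ => (0 : ℂ)) V = 0
    simp [orbit]
  map_add' D E := by
    rw [← orbit_add, Matrix.diagonal_add]
    rfl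
  commutes' c := by
    change orbit (algebraMap ℂ (Matrix n n ℂ) c) V = _
    rw [Algebra.algebraMap_eq_smul_one, orbit_smul, orbit_one_left]
  map_star' D := by
    simp [orbit, mul_assoc, Matrix.star_eq_conjTranspose, Matrix.diagonal_conjTranspose]

theorem orbit_diagonal_isSelfAdjoint (D : n → ℝ) (V : Matrix.unitaryGroup n ℂ) :
    IsSelfAdjoint (orbit (Matrix.diagonal fun i => (D i : ℂ)) V) := by
  refine IsSelfAdjoint.map (x := fun i => (D i : ℂ)) ?_ (orbitDiagonalHom V)
  ext i
  simp

theorem spectrum_orbit_diagonal (D : n → ℝ) (V : Matrix.unitaryGroup n ℂ) :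
    spectrum ℝ (orbit (Matrix.diagonal fun i => (D i : ℂ)) V) ⊆ Set.range D := by
  intro x hx
  have h := spectrum.algebraMap_mem ℂ hx
  rw [orbit, Unitary.spectrum_star_right_conjugate, spectrum_diagonal] at h
  obtain ⟨i, hi⟩ := h
  exact ⟨i, Complex.ofReal_injective hi⟩

/-- The functional calculus acts on the eigenvalues; every function agrees with a polynomial on
finitely many points. -/
theorem cfc_orbit_diagonal (f : ℝ → ℝ) (D : n → ℝ) (V : Matrix.unitaryGroup n ℂ) :
    cfc f (orbit (Matrix.diagonal fun i => (D i : ℂ)) V) =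
      orbit (Matrix.diagonal fun i => (f (D i) : ℂ)) V := by
  set p : Polynomial ℝ := Lagrange.interpolate (Finset.univ.image D) id f with hp
  have heval : ∀ i, p.eval (D i) = f (D i) := fun i =>
    Lagrange.eval_interpolate_at_node (v := id) f (Set.injOn_id _)
      (Finset.mem_image_of_mem D (Finset.mem_univ i))
  have hcongr : cfc f (orbit (Matrix.diagonal fun i => (D i : ℂ)) V) =
      cfc p.eval (orbit (Matrix.diagonal fun i => (D i : ℂ)) V) := by
    refine cfc_congr fun x hx => ?_
    obtain ⟨i, rfl⟩ := spectrum_orbit_diagonal D V hx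
    exact (heval i).symm
  rw [hcongr, cfc_polynomial p _ (orbit_diagonal_isSelfAdjoint D V)]
  change Polynomial.aeval (((orbitDiagonalHom V).restrictScalars ℝ) fun i => (D i : ℂ)) p =
    ((orbitDiagonalHom V).restrictScalars ℝ) fun i => (f (D i) : ℂ)
  rw [Polynomial.aeval_algHom_apply]
  congr 1
  ext i
  rw [← heval, Polynomial.aeval_pi_apply₂]
  exact (Polynomial.aeval_algebraMap_apply ℂ (D i) p).trans (by simp)


theorem trace_mul_cfc_orbit_diagonal (ρ : Matrix n n ℂ) (f : ℝ → ℝ) (D : n → ℝ)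
    (V : Matrix.unitaryGroup n ℂ) :
    (ρ * cfc f (orbit (Matrix.diagonal fun i => (D i : ℂ)) V)).trace.re =
      ∑ i, ((star (V : Matrix n n ℂ) * ρ * (V : Matrix n n ℂ)) i i).re * f (D i) := by
  rw [cfc_orbit_diagonal, orbit, ← mul_assoc, ← mul_assoc, Matrix.trace_mul_comm, ← mul_assoc,
    ← mul_assoc, Matrix.trace, Complex.re_sum]
  simp [Matrix.mul_diagonal]

theorem cfc_orbit {X : Matrix n n ℂ} (hX : X.IsHermitian) (f : ℝ → ℝ)
    (U : Matrix.unitaryGroup n ℂ) : cfc f (orbit X U) = orbit (cfc f X) U := by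
  obtain ⟨D, V, rfl⟩ := exists_orbit_diagonal hX
  rw [orbit_orbit, cfc_orbit_diagonal, cfc_orbit_diagonal, orbit_orbit]

theorem cfc_add_smul_one {X : Matrix n n ℂ} (hX : X.IsHermitian) (f : ℝ → ℝ) (ε : ℝ) :
    cfc f (X + (ε : ℂ) • 1) = cfc (fun x => f (x + ε)) X := by
  obtain ⟨D, V, rfl⟩ := exists_orbit_diagonal hX
  have h : orbit (Matrix.diagonal fun i => (D i : ℂ)) V + (ε : ℂ) • 1 =
      orbit (Matrix.diagonal fun i => ((D i + ε : ℝ) : ℂ)) V := by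
    rw [← orbit_one_left V, ← orbit_smul, ← orbit_add, ← Matrix.diagonal_one,
      ← Matrix.diagonal_smul, Matrix.diagonal_add]
    simp
  rw [h, cfc_orbit_diagonal, cfc_orbit_diagonal]

end EigenBasis

/-! ### The convex set of states -/

section States

variable {n : Type*} [Fintype n]

theorem isState_convex : Convex ℝ {X : Matrix n n ℂ | IsState X} := by
  intro X hX Y hY a b ha hb hab
  refine ⟨(hX.posSemidef.smul ha).add (hY.posSemidef.smul hb), ?_⟩
  rw [Matrix.trace_add, Matrix.trace_smul, Matrix.trace_smul, hX.trace_eq_one, hY.trace_eq_one,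
    ← add_smul, hab, one_smul]

variable [DecidableEq n]

open scoped Matrix.Norms.L2Operator MatrixOrder in
theorem isState_isClosed : IsClosed {X : Matrix n n ℂ | IsState X} := by
  have h : {X : Matrix n n ℂ | IsState X} = {X | 0 ≤ X} ∩ {X | X.trace = 1} := by
    ext X
    exact ⟨fun h => ⟨h.posSemidef.nonneg, h.trace_eq_one⟩,
      fun h => ⟨Matrix.nonneg_iff_posSemidef.1 h.1, h.2⟩⟩
  rw [h]
  exact CStarAlgebra.isClosed_nonneg.inter (isClosed_eq (by fun_prop) continuous_const)

theorem isState_orbit {ρ : Matrix n n ℂ} (hρ : IsState ρ) (U : Matrix.unitaryGroup n ℂ) :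
    IsState (orbit ρ U) :=
  ⟨hρ.posSemidef.mul_mul_conjTranspose_same _, by rw [trace_orbit, hρ.trace_eq_one]⟩

theorem isState_star_mul_mul {ρ : Matrix n n ℂ} (hρ : IsState ρ)
    (U : Matrix.unitaryGroup n ℂ) :
    IsState (star (U : Matrix n n ℂ) * ρ * (U : Matrix n n ℂ)) := by
  simpa [orbit] using isState_orbit hρ U⁻¹

open scoped MatrixOrder in
theorem IsState.le_one {ρ : Matrix n n ℂ} (hρ : IsState ρ) : ρ ≤ 1 := by
  obtain ⟨D, V, h⟩ := exists_orbit_diagonal hρ.posSemidef.isHermitian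
  have hD : star (V : Matrix n n ℂ) * ρ * (V : Matrix n n ℂ) =
      Matrix.diagonal fun i => (D i : ℂ) := by
    rw [h, star_mul_orbit_mul]
  have hs := isState_star_mul_mul hρ V
  rw [hD] at hs
  have hnn : ∀ i, 0 ≤ D i := fun i => by
    have := hs.posSemidef.diag_nonneg (i := i)
    simpa using this
  have hsum : ∑ i, D i = 1 := by
    have := hs.trace_eq_one
    rw [Matrix.trace_diagonal] at this
    exact_mod_cast this
  rw [Matrix.le_iff]
  have h1 : 1 - ρ = orbit (Matrix.diagonal fun i => ((1 - D i : ℝ) : ℂ)) V := by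
    rw [h, sub_eq_iff_eq_add, ← orbit_add, Matrix.diagonal_add]
    simp [orbit_one_left]
  rw [h1]
  refine Matrix.PosSemidef.mul_mul_conjTranspose_same (Matrix.PosSemidef.diagonal fun i => ?_) _
  have := Finset.single_le_sum (fun j _ => hnn j) (Finset.mem_univ i)
  simp only [Pi.zero_apply]
  exact_mod_cast sub_nonneg.2 (hsum ▸ this)

open scoped Matrix.Norms.L2Operator MatrixOrder in
theorem spectrum_subset_Icc {X : Matrix n n ℂ} (h0 : 0 ≤ X) (h1 : X ≤ 1) :
    spectrum ℝ X ⊆ Set.Icc 0 1 := fun _ hx =>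
  ⟨spectrum_nonneg_of_nonneg h0 hx, (CFC.le_one_iff (R := ℝ) X).1 h1 _ hx⟩

open scoped MatrixOrder in
theorem IsState.spectrum_subset {ρ : Matrix n n ℂ} (hρ : IsState ρ) :
    spectrum ℝ ρ ⊆ Set.Icc 0 1 :=
  spectrum_subset_Icc hρ.posSemidef.nonneg hρ.le_one

/-- On states, the functional calculus of a function continuous on `[0, 1]` is continuous. -/
theorem continuousOn_cfc_isState {f : ℝ → ℝ} (hf : ContinuousOn f (Set.Icc 0 1)) :
    ContinuousOn (cfc f) {X : Matrix n n ℂ | IsState X} := by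
  open scoped Matrix.Norms.L2Operator in
  exact (continuousOn_cfc (Matrix n n ℂ) isCompact_Icc f hf).mono fun X hX =>
    ⟨hX.posSemidef.isHermitian, hX.spectrum_subset⟩

open scoped Matrix.Norms.L2Operator MatrixOrder in
theorem re_trace_mul_le {ρ X Y : Matrix n n ℂ} (hρ : ρ.PosSemidef) (h : X ≤ Y) :
    (ρ * X).trace.re ≤ (ρ * Y).trace.re := by
  obtain ⟨s, hs⟩ := CStarAlgebra.nonneg_iff_eq_star_mul_self.1 hρ.nonneg
  rw [Matrix.star_eq_conjTranspose] at hs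
  have h1 := (((Matrix.le_iff.1 h).mul_mul_conjTranspose_same s).trace_nonneg)
  rw [Matrix.trace_mul_cycle, ← hs, mul_sub, Matrix.trace_sub] at h1
  have h2 := (Complex.le_def.1 h1).1
  simpa using h2

open scoped Matrix.Norms.L2Operator in
/-- Jensen's inequality for a concave function of a random state. -/
theorem integral_concave_le {g : Matrix n n ℂ → ℝ}
    (hg : ConcaveOn ℝ {X : Matrix n n ℂ | IsState X} g)
    (hgc : ContinuousOn g {X : Matrix n n ℂ | IsState X})
    {m : Type*} [Fintype m] [DecidableEq m] {F : Matrix.unitaryGroup m ℂ → Matrix n n ℂ}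
    (hF : Continuous F) (hFs : ∀ U, IsState (F U)) :
    ∫ U, g (F U) ∂(unitaryHaar m) ≤ g (∫ U, F U ∂(unitaryHaar m)) :=
  hg.le_map_integral hgc isState_isClosed (Filter.Eventually.of_forall hFs)
    (integrable_unitaryHaar hF) (integrable_unitaryHaar (hgc.comp_continuous hF hFs))

end States

/-! ### Concavity of the trace against a logarithm -/

section Logarithm

variable {n : Type*} [Fintype n] [DecidableEq n]

/-- An eigenvector of `σ` for the eigenvalue zero carries no weight in `ρ`. -/
theorem diag_eq_zero_of_ker_le {ρ : Matrix n n ℂ} {D : n → ℝ} {V : Matrix.unitaryGroup n ℂ}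
    (hker : ∀ v : n → ℂ, (orbit (Matrix.diagonal fun i => (D i : ℂ)) V).mulVec v = 0 →
      ρ.mulVec v = 0) {i : n} (hi : D i = 0) :
    (star (V : Matrix n n ℂ) * ρ * (V : Matrix n n ℂ)) i i = 0 := by
  have h : ρ.mulVec ((V : Matrix n n ℂ).mulVec (Pi.single i 1)) = 0 := by
    refine hker _ ?_
    rw [Matrix.mulVec_mulVec, orbit, mul_assoc, Unitary.coe_star_mul_self, mul_one,
      ← Matrix.mulVec_mulVec, Matrix.mulVec_single_one]
    have : (Matrix.diagonal fun i => (D i : ℂ)).col i = 0 := by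
      ext j
      by_cases hij : j = i <;> simp [hij, hi]
    rw [this, Matrix.mulVec_zero]
  have h2 : ((star (V : Matrix n n ℂ) * ρ * (V : Matrix n n ℂ)).mulVec (Pi.single i 1)) i = 0 := by
    rw [mul_assoc, ← Matrix.mulVec_mulVec, ← Matrix.mulVec_mulVec, h, Matrix.mulVec_zero]
    rfl
  simpa using h2

theorem diag_re_nonneg {ρ : Matrix n n ℂ} (hρ : ρ.PosSemidef) (V : Matrix.unitaryGroup n ℂ)
    (i : n) : 0 ≤ ((star (V : Matrix n n ℂ) * ρ * (V : Matrix n n ℂ)) i i).re :=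
  (Complex.le_def.1 (hρ.conjTranspose_mul_mul_same (V : Matrix n n ℂ)).diag_nonneg).1

/-- Shifting the spectrum of `σ` increases `Tr ρ ln σ`; the eigenvectors of `σ` for the eigenvalue
zero, at which `Real.log` takes the value zero, carry no weight in `ρ`. -/
theorem re_trace_mul_log_le {ρ σ : Matrix n n ℂ} (hρ : ρ.PosSemidef) (hσ : σ.PosSemidef)
    (hker : ∀ v : n → ℂ, σ.mulVec v = 0 → ρ.mulVec v = 0) {ε : ℝ} (hε : 0 < ε) :
    (ρ * cfc Real.log σ).trace.re ≤ (ρ * cfc (fun x => Real.log (x + ε)) σ).trace.re := by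
  obtain ⟨D, V, rfl⟩ := exists_orbit_diagonal hσ.isHermitian
  have hD : ∀ i, 0 ≤ D i := fun i => by
    have := diag_re_nonneg hσ V i
    rwa [star_mul_orbit_mul, Matrix.diagonal_apply_eq, Complex.ofReal_re] at this
  rw [trace_mul_cfc_orbit_diagonal, trace_mul_cfc_orbit_diagonal]
  refine Finset.sum_le_sum fun i _ => ?_
  rcases (hD i).eq_or_lt with h | h
  · rw [diag_eq_zero_of_ker_le hker h.symm]
    simp
  · exact mul_le_mul_of_nonneg_left (Real.log_le_log h (by linarith)) (diag_re_nonneg hρ V i)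

theorem tendsto_re_trace_mul_log {ρ σ : Matrix n n ℂ} (hσ : σ.PosSemidef)
    (hker : ∀ v : n → ℂ, σ.mulVec v = 0 → ρ.mulVec v = 0) :
    Filter.Tendsto (fun ε : ℝ => (ρ * cfc (fun x => Real.log (x + ε)) σ).trace.re)
      (nhdsWithin 0 (Set.Ioi 0)) (nhds (ρ * cfc Real.log σ).trace.re) := by
  obtain ⟨D, V, rfl⟩ := exists_orbit_diagonal hσ.isHermitian
  simp_rw [trace_mul_cfc_orbit_diagonal]
  refine tendsto_finsetSum _ fun i _ => ?_
  by_cases h : D i = 0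
  · rw [diag_eq_zero_of_ker_le hker h]
    simp
  · refine Filter.Tendsto.const_mul _ (tendsto_nhdsWithin_of_tendsto_nhds ?_)
    have : ContinuousAt (fun ε : ℝ => Real.log (D i + ε)) 0 :=
      ContinuousAt.log (by fun_prop) (by simpa using h)
    simpa [ContinuousAt] using this

open scoped Matrix.Norms.L2Operator MatrixOrder in
/-- The operator concavity of the logarithm, on states shifted away from zero. -/
theorem concaveOn_re_trace_mul_log {ρ : Matrix n n ℂ} (hρ : ρ.PosSemidef) {ε : ℝ} (hε : 0 < ε) :
    ConcaveOn ℝ {X : Matrix n n ℂ | IsState X}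
      fun X => (ρ * cfc (fun x => Real.log (x + ε)) X).trace.re := by
  refine ⟨isState_convex, fun X hX Y hY a b ha hb hab => ?_⟩
  have hpos : ∀ Z : Matrix n n ℂ, IsState Z → IsStrictlyPositive (Z + (ε : ℂ) • 1) := by
    intro Z hZ
    rw [Matrix.isStrictlyPositive_iff_posDef]
    refine Matrix.PosDef.posSemidef_add hZ.posSemidef ?_
    exact Matrix.PosDef.one.smul (by exact_mod_cast hε)
  have hconv := isState_convex hX hY ha hb hab
  have hsum : a • X + b • Y + (ε : ℂ) • (1 : Matrix n n ℂ) =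
      a • (X + (ε : ℂ) • 1) + b • (Y + (ε : ℂ) • 1) := by
    rw [smul_add, smul_add, add_add_add_comm, ← add_smul, hab, one_smul]
  have h := CFC.concaveOn_log.2 (hpos X hX) (hpos Y hY) ha hb hab
  rw [← hsum] at h
  simp only [CFC.log] at h
  rw [cfc_add_smul_one hX.posSemidef.isHermitian, cfc_add_smul_one hY.posSemidef.isHermitian,
    cfc_add_smul_one (IsState.posSemidef hconv).isHermitian] at h
  have h' := re_trace_mul_le hρ h
  simpa [mul_add] using h'

theorem continuousOn_re_trace_mul_log (ρ : Matrix n n ℂ) {ε : ℝ} (hε : 0 < ε) :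
    ContinuousOn (fun X => (ρ * cfc (fun x => Real.log (x + ε)) X).trace.re)
      {X : Matrix n n ℂ | IsState X} := by
  have h : ContinuousOn (fun x => Real.log (x + ε)) (Set.Icc 0 1) :=
    ContinuousOn.log (by fun_prop) fun x hx => by linarith [hx.1]
  have h2 : Continuous fun M : Matrix n n ℂ => (ρ * M).trace.re := by fun_prop
  exact h2.comp_continuousOn (continuousOn_cfc_isState h)

open scoped Matrix.Norms.L2Operator in
/-- Jensen's inequality for `σ ↦ Tr ρ ln σ`, obtained from the shifted logarithms `ln (x + ε)`
as `ε` tends to zero. -/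
theorem integral_re_trace_mul_log_le {ρ : Matrix n n ℂ} (hρ : ρ.PosSemidef)
    {m : Type*} [Fintype m] [DecidableEq m] {F : Matrix.unitaryGroup m ℂ → Matrix n n ℂ}
    (hF : Continuous F) (hFs : ∀ U, IsState (F U))
    (hker : ∀ U, ∀ v : n → ℂ, (F U).mulVec v = 0 → ρ.mulVec v = 0)
    (hint : Integrable (fun U => (ρ * cfc Real.log (F U)).trace.re) (unitaryHaar m))
    (hmean : (∫ U, F U ∂(unitaryHaar m)).PosSemidef)
    (hmean' : ∀ v : n → ℂ, (∫ U, F U ∂(unitaryHaar m)).mulVec v = 0 → ρ.mulVec v = 0) :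
    ∫ U, (ρ * cfc Real.log (F U)).trace.re ∂(unitaryHaar m) ≤
      (ρ * cfc Real.log (∫ U, F U ∂(unitaryHaar m))).trace.re := by
  refine ge_of_tendsto (tendsto_re_trace_mul_log hmean hmean') ?_
  filter_upwards [self_mem_nhdsWithin] with ε hε
  refine le_trans (integral_mono hint (integrable_unitaryHaar
    ((continuousOn_re_trace_mul_log ρ hε).comp_continuous hF hFs)) fun U =>
      re_trace_mul_log_le hρ (hFs U).posSemidef (hker U) hε) ?_
  exact integral_concave_le (concaveOn_re_trace_mul_log hρ hε)
    (continuousOn_re_trace_mul_log ρ hε) hF hFs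

end Logarithm

/-! ### Concavity of the fidelity -/

section Fidelity

variable {n : Type*} [Fintype n] [DecidableEq n]

open scoped Matrix.Norms.L2Operator MatrixOrder

theorem cfc_sqrt_nonneg (ρ : Matrix n n ℂ) : 0 ≤ cfc Real.sqrt ρ :=
  cfc_nonneg fun x _ => Real.sqrt_nonneg x

theorem cfc_sqrt_mul_self {ρ : Matrix n n ℂ} (hρ : ρ.PosSemidef) :
    cfc Real.sqrt ρ * cfc Real.sqrt ρ = ρ := by
  have h0 : 0 ≤ ρ := hρ.nonneg
  rw [← cfc_mul Real.sqrt Real.sqrt ρ]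
  conv_rhs => rw [← cfc_id ℝ ρ]
  exact cfc_congr fun x hx => Real.mul_self_sqrt (spectrum_nonneg_of_nonneg h0 hx)

theorem sqrt_conj_mono {X Y : Matrix n n ℂ} (ρ : Matrix n n ℂ) (h : X ≤ Y) :
    cfc Real.sqrt ρ * X * cfc Real.sqrt ρ ≤ cfc Real.sqrt ρ * Y * cfc Real.sqrt ρ := by
  have hs : IsSelfAdjoint (cfc Real.sqrt ρ) := .of_nonneg (cfc_sqrt_nonneg ρ)
  simpa [hs.star_eq] using star_left_conjugate_le_conjugate h (cfc Real.sqrt ρ)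

theorem sqrt_conj_nonneg {X : Matrix n n ℂ} (ρ : Matrix n n ℂ) (h : 0 ≤ X) :
    0 ≤ cfc Real.sqrt ρ * X * cfc Real.sqrt ρ := by
  simpa using sqrt_conj_mono ρ h

theorem sqrt_conj_le_one {ρ X : Matrix n n ℂ} (hρ : IsState ρ) (h : X ≤ 1) :
    cfc Real.sqrt ρ * X * cfc Real.sqrt ρ ≤ 1 := by
  refine (sqrt_conj_mono ρ h).trans ?_
  rw [mul_one, cfc_sqrt_mul_self hρ.posSemidef]
  exact hρ.le_one

theorem cfc_real_sqrt_eq_sqrt {X : Matrix n n ℂ} (h : 0 ≤ X) : cfc Real.sqrt X = CFC.sqrt X := by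
  rw [CFC.sqrt_eq_real_sqrt X h, cfcₙ_eq_cfc]

/-- Concavity of the fidelity in its second argument, from operator concavity of the square
root. -/
theorem concaveOn_fidelity (ρ : Matrix n n ℂ) :
    ConcaveOn ℝ {X : Matrix n n ℂ | IsState X} (fidelity ρ) := by
  refine ⟨isState_convex, fun X hX Y hY a b ha hb hab => ?_⟩
  have hX0 := sqrt_conj_nonneg ρ hX.posSemidef.nonneg
  have hY0 := sqrt_conj_nonneg ρ hY.posSemidef.nonneg
  have hZ0 := sqrt_conj_nonneg ρ (isState_convex hX hY ha hb hab).posSemidef.nonneg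
  have h := CFC.concaveOn_sqrt.2 (Set.mem_Ici.2 hX0) (Set.mem_Ici.2 hY0) ha hb hab
  have hsum : cfc Real.sqrt ρ * (a • X + b • Y) * cfc Real.sqrt ρ =
      a • (cfc Real.sqrt ρ * X * cfc Real.sqrt ρ) +
        b • (cfc Real.sqrt ρ * Y * cfc Real.sqrt ρ) := by
    simp [mul_add, add_mul]
  rw [← hsum, ← cfc_real_sqrt_eq_sqrt hX0, ← cfc_real_sqrt_eq_sqrt hY0,
    ← cfc_real_sqrt_eq_sqrt hZ0] at h
  simpa [fidelity] using re_trace_mul_le Matrix.PosSemidef.one h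

theorem continuousOn_fidelity {ρ : Matrix n n ℂ} (hρ : IsState ρ) :
    ContinuousOn (fidelity ρ) {X : Matrix n n ℂ | IsState X} := by
  have h1 := continuousOn_cfc (Matrix n n ℂ) (p := IsSelfAdjoint) (isCompact_Icc (a := (0 : ℝ))
    (b := 1)) Real.sqrt Real.continuous_sqrt.continuousOn
  have h2 : ContinuousOn (fun X => cfc Real.sqrt (cfc Real.sqrt ρ * X * cfc Real.sqrt ρ))
      {X : Matrix n n ℂ | IsState X} :=
    h1.comp (f := fun X => cfc Real.sqrt ρ * X * cfc Real.sqrt ρ) (by fun_prop) fun X hX => by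
      have h0 := sqrt_conj_nonneg ρ hX.posSemidef.nonneg
      exact ⟨.of_nonneg h0, spectrum_subset_Icc h0 (sqrt_conj_le_one hρ hX.le_one)⟩
  have h3 : Continuous fun M : Matrix n n ℂ => M.trace.re := by fun_prop
  exact h3.comp_continuousOn h2

/-- The overlap is a lower bound for the fidelity, because `x ≤ √x` on `[0, 1]`. -/
theorem re_trace_mul_le_fidelity {ρ σ : Matrix n n ℂ} (hρ : IsState ρ) (hσ : IsState σ) :
    (ρ * σ).trace.re ≤ fidelity ρ σ := by
  have h0 := sqrt_conj_nonneg ρ hσ.posSemidef.nonneg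
  have hspec := spectrum_subset_Icc h0 (sqrt_conj_le_one hρ hσ.le_one)
  have hle : cfc Real.sqrt ρ * σ * cfc Real.sqrt ρ ≤
      cfc Real.sqrt (cfc Real.sqrt ρ * σ * cfc Real.sqrt ρ) := by
    conv_lhs => rw [← cfc_id ℝ (cfc Real.sqrt ρ * σ * cfc Real.sqrt ρ)]
    refine cfc_mono fun x hx => ?_
    exact Real.le_sqrt_of_sq_le (pow_le_of_le_one (hspec hx).1 (hspec hx).2 two_ne_zero)
  have h := re_trace_mul_le Matrix.PosSemidef.one hle
  rw [one_mul, one_mul, Matrix.trace_mul_cycle, cfc_sqrt_mul_self hρ.posSemidef] at h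
  exact h

end Fidelity

/-! ### A state and the product of its marginals -/

section Marginals

variable {A B : Type*} [Fintype A] [Fintype B]

theorem isState_marginalA {ρ : Matrix (A × B) (A × B) ℂ} (hρ : IsState ρ) :
    IsState (marginalA ρ) := by
  refine ⟨?_, by rw [trace_marginalA, hρ.trace_eq_one]⟩
  have h : marginalA ρ = ∑ b, ρ.submatrix (fun a => (a, b)) (fun a => (a, b)) := by
    ext a a'
    simp [marginalA, Matrix.sum_apply]
  rw [h]
  exact Matrix.posSemidef_sum _ fun b _ => hρ.posSemidef.submatrix _

theorem isState_marginalB {ρ : Matrix (A × B) (A × B) ℂ} (hρ : IsState ρ) :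
    IsState (marginalB ρ) := by
  refine ⟨?_, by rw [trace_marginalB, hρ.trace_eq_one]⟩
  have h : marginalB ρ = ∑ a, ρ.submatrix (fun b => (a, b)) (fun b => (a, b)) := by
    ext b b'
    simp [marginalB, Matrix.sum_apply]
  rw [h]
  exact Matrix.posSemidef_sum _ fun b _ => hρ.posSemidef.submatrix _

theorem isState_marginalProduct {ρ : Matrix (A × B) (A × B) ℂ} (hρ : IsState ρ) :
    IsState (marginalProduct ρ) :=
  ⟨(isState_marginalA hρ).posSemidef.kronecker (isState_marginalB hρ).posSemidef, by
    rw [marginalProduct, Matrix.trace_kronecker, trace_marginalA, trace_marginalB,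
      hρ.trace_eq_one, one_mul]⟩

/-- A nonnegative array vanishes wherever one of its two marginals does. -/
theorem weight_eq_zero {p : A → ℝ} {q : B → ℝ} {w : A × B → ℝ} (hw : ∀ k, 0 ≤ w k)
    (hp : ∀ i, ∑ j, w (i, j) = p i) (hq : ∀ j, ∑ i, w (i, j) = q j) {k : A × B}
    (hk : p k.1 * q k.2 = 0) : w k = 0 := by
  rcases mul_eq_zero.1 hk with h | h
  · rw [← hp] at h
    exact (Finset.sum_eq_zero_iff_of_nonneg fun j _ => hw (k.1, j)).1 h k.2 (Finset.mem_univ _)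
  · rw [← hq] at h
    exact (Finset.sum_eq_zero_iff_of_nonneg fun i _ => hw (i, k.2)).1 h k.1 (Finset.mem_univ _)

variable [DecidableEq A] [DecidableEq B]

/-- The tensor product of two unitary matrices. -/
def unitaryKronecker (V : Matrix.unitaryGroup A ℂ) (W : Matrix.unitaryGroup B ℂ) :
    Matrix.unitaryGroup (A × B) ℂ :=
  ⟨(V : Matrix A A ℂ) ⊗ₖ (W : Matrix B B ℂ), Matrix.kronecker_mem_unitary V.2 W.2⟩

theorem orbit_kronecker (X : Matrix A A ℂ) (Y : Matrix B B ℂ) (V : Matrix.unitaryGroup A ℂ)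
    (W : Matrix.unitaryGroup B ℂ) :
    orbit (X ⊗ₖ Y) (unitaryKronecker V W) = orbit X V ⊗ₖ orbit Y W := by
  simp only [orbit, unitaryKronecker, Matrix.star_eq_conjTranspose, Matrix.conjTranspose_kronecker,
    ← Matrix.mul_kronecker_mul]

theorem trace_conj_mul {n : Type*} [Fintype n] [DecidableEq n] (X Y : Matrix n n ℂ)
    (U : Matrix.unitaryGroup n ℂ) :
    (star (U : Matrix n n ℂ) * X * (U : Matrix n n ℂ) * Y).trace = (X * orbit Y U).trace := by
  rw [orbit, ← mul_assoc, Matrix.trace_mul_comm (X * _), mul_assoc, mul_assoc]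

theorem marginalA_conj (ρ : Matrix (A × B) (A × B) ℂ) (V : Matrix.unitaryGroup A ℂ)
    (W : Matrix.unitaryGroup B ℂ) :
    marginalA (star (unitaryKronecker V W : Matrix (A × B) (A × B) ℂ) * ρ *
      (unitaryKronecker V W : Matrix (A × B) (A × B) ℂ)) =
      star (V : Matrix A A ℂ) * marginalA ρ * (V : Matrix A A ℂ) := by
  refine Matrix.ext_iff_trace_mul_right.2 fun M => ?_
  rw [← trace_mul_kronecker_one, trace_conj_mul, orbit_kronecker, orbit_one_left,
    trace_mul_kronecker_one, trace_conj_mul]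

theorem marginalB_conj (ρ : Matrix (A × B) (A × B) ℂ) (V : Matrix.unitaryGroup A ℂ)
    (W : Matrix.unitaryGroup B ℂ) :
    marginalB (star (unitaryKronecker V W : Matrix (A × B) (A × B) ℂ) * ρ *
      (unitaryKronecker V W : Matrix (A × B) (A × B) ℂ)) =
      star (W : Matrix B B ℂ) * marginalB ρ * (W : Matrix B B ℂ) := by
  refine Matrix.ext_iff_trace_mul_right.2 fun M => ?_
  rw [← trace_mul_one_kronecker, trace_conj_mul, orbit_kronecker, orbit_one_left,
    trace_mul_one_kronecker, trace_conj_mul]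

/-- A product orthonormal basis diagonalizing both marginals of a state. The eigenvalues `p` and `q`
of the marginals are the marginals of the diagonal of the state in that basis. -/
theorem exists_marginal_eigenbasis {ρ : Matrix (A × B) (A × B) ℂ} (hρ : IsState ρ) :
    ∃ (p : A → ℝ) (q : B → ℝ) (V : Matrix.unitaryGroup A ℂ) (W : Matrix.unitaryGroup B ℂ)
      (w : A × B → ℝ),
      marginalA ρ = orbit (Matrix.diagonal fun i => (p i : ℂ)) V ∧
      marginalB ρ = orbit (Matrix.diagonal fun j => (q j : ℂ)) W ∧
      marginalProduct ρ =
        orbit (Matrix.diagonal fun k => ((p k.1 * q k.2 : ℝ) : ℂ)) (unitaryKronecker V W) ∧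
      (∀ k, (star (unitaryKronecker V W : Matrix (A × B) (A × B) ℂ) * ρ *
        (unitaryKronecker V W : Matrix (A × B) (A × B) ℂ)) k k = (w k : ℂ)) ∧
      (∀ k, 0 ≤ w k) ∧ (∀ i, ∑ j, w (i, j) = p i) ∧ (∀ j, ∑ i, w (i, j) = q j) := by
  obtain ⟨p, V, hp⟩ := exists_orbit_diagonal (isState_marginalA hρ).posSemidef.isHermitian
  obtain ⟨q, W, hq⟩ := exists_orbit_diagonal (isState_marginalB hρ).posSemidef.isHermitian
  set Z := star (unitaryKronecker V W : Matrix (A × B) (A × B) ℂ) * ρ *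
        (unitaryKronecker V W : Matrix (A × B) (A × B) ℂ) with hZ
  have hZs : IsState Z := isState_star_mul_mul hρ _
  have hdiag : ∀ k, Z k k = ((Z k k).re : ℂ) := fun k => by
    have := Complex.le_def.1 (hZs.posSemidef.diag_nonneg (i := k))
    exact Complex.ext rfl (by simpa using this.2.symm)
  refine ⟨p, q, V, W, fun k => (Z k k).re, hp, hq, ?_, hdiag,
    fun k => (Complex.le_def.1 hZs.posSemidef.diag_nonneg).1, fun i => ?_, fun j => ?_⟩
  · rw [marginalProduct, hp, hq, ← orbit_kronecker, Matrix.diagonal_kronecker_diagonal]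
    simp
  · have h : marginalA Z i i = (p i : ℂ) := by
      rw [hZ, marginalA_conj, hp, star_mul_orbit_mul, Matrix.diagonal_apply_eq]
    rw [← Complex.ofReal_re (p i), ← h]
    simp [marginalA]
  · have h : marginalB Z j j = (q j : ℂ) := by
      rw [hZ, marginalB_conj, hq, star_mul_orbit_mul, Matrix.diagonal_apply_eq]
    rw [← Complex.ofReal_re (q j), ← h]
    simp [marginalB]

/-- The support of a state lies in the support of the product of its marginals. -/
theorem ker_marginalProduct_le {ρ : Matrix (A × B) (A × B) ℂ} (hρ : IsState ρ) (v : A × B → ℂ)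
    (hv : (marginalProduct ρ).mulVec v = 0) : ρ.mulVec v = 0 := by
  obtain ⟨p, q, V, W, w, -, -, hprod, hZw, hw, hp, hq⟩ := exists_marginal_eigenbasis hρ
  set K : Matrix (A × B) (A × B) ℂ := (unitaryKronecker V W : Matrix (A × B) (A × B) ℂ) with hK
  have hKK : star K * K = 1 := Unitary.coe_star_mul_self _
  have hKK' : K * star K = 1 := Unitary.coe_mul_star_self _
  have hu : ∀ k, ((p k.1 * q k.2 : ℝ) : ℂ) * (star K).mulVec v k = 0 := by
    intro k
    have h : (star K).mulVec ((marginalProduct ρ).mulVec v) k = 0 := by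
      rw [hv, Matrix.mulVec_zero]; rfl
    rw [hprod, orbit, ← hK, Matrix.mulVec_mulVec, ← mul_assoc, ← mul_assoc, hKK, one_mul,
      ← Matrix.mulVec_mulVec, Matrix.mulVec_diagonal] at h
    exact h
  have hcol : ∀ k l, (star K * ρ * K) k l * (star K).mulVec v l = 0 := by
    intro k l
    rcases mul_eq_zero.1 (hu l) with h | h
    · have hZ : (star K * ρ * K).PosSemidef :=
        hρ.posSemidef.conjTranspose_mul_mul_same K
      have h0 := (hZ.dotProduct_mulVec_zero_iff (Pi.single l 1)).1 (by
        rw [Matrix.mulVec_single_one]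
        simp [hZw, weight_eq_zero hw hp hq (Complex.ofReal_eq_zero.1 h)])
      rw [Matrix.mulVec_single_one] at h0
      have := congrFun h0 k
      rw [Matrix.col_apply] at this
      rw [this]
      simp
    · rw [h, mul_zero]
  have h1 : (star K * ρ * K).mulVec ((star K).mulVec v) = 0 := by
    ext k
    exact Finset.sum_eq_zero fun l _ => hcol k l
  have h2 : K.mulVec ((star K * ρ * K).mulVec ((star K).mulVec v)) = ρ.mulVec v := by
    rw [Matrix.mulVec_mulVec, Matrix.mulVec_mulVec, ← mul_assoc, ← mul_assoc, hKK', one_mul,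
      mul_assoc, hKK', mul_one]
  rw [← h2, h1, Matrix.mulVec_zero]

/-- Additivity of the logarithm on a product: the cross term of the mutual information is the sum of
the negative entropies of the marginals. -/
theorem re_trace_mul_log_marginalProduct {ρ : Matrix (A × B) (A × B) ℂ} (hρ : IsState ρ) :
    (ρ * cfc Real.log (marginalProduct ρ)).trace.re =
      (cfc (fun x => x * Real.log x) (marginalA ρ)).trace.re +
        (cfc (fun x => x * Real.log x) (marginalB ρ)).trace.re := by
  obtain ⟨p, q, V, W, w, hA, hB, hprod, hZw, hw, hp, hq⟩ := exists_marginal_eigenbasis hρ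
  rw [hprod, hA, hB, trace_mul_cfc_orbit_diagonal, cfc_orbit_diagonal, cfc_orbit_diagonal,
    trace_orbit, trace_orbit, Matrix.trace_diagonal, Matrix.trace_diagonal]
  simp only [hZw, ← Complex.ofReal_sum, Complex.ofReal_re]
  have hterm : ∀ k : A × B, w k * Real.log (p k.1 * q k.2) =
      w k * Real.log (p k.1) + w k * Real.log (q k.2) := by
    intro k
    by_cases hk : p k.1 * q k.2 = 0
    · rw [weight_eq_zero hw hp hq hk]
      ring
    · rw [Real.log_mul (left_ne_zero_of_mul hk) (right_ne_zero_of_mul hk), mul_add]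
  simp_rw [hterm]
  rw [Finset.sum_add_distrib, Fintype.sum_prod_type, Fintype.sum_prod_type_right]
  simp_rw [← Finset.sum_mul, hp, hq]

end Marginals

/-! ### The orbit averages -/

section OrbitAverage

variable {A B : Type*} [Fintype A] [Fintype B] [DecidableEq A] [DecidableEq B]

theorem isState_pulledProduct {ρ : Matrix (A × B) (A × B) ℂ} (hρ : IsState ρ)
    (U : Matrix.unitaryGroup (A × B) ℂ) : IsState (pulledProduct ρ U) :=
  isState_star_mul_mul (isState_marginalProduct (isState_orbit hρ U)) U

theorem ker_pulledProduct_le {ρ : Matrix (A × B) (A × B) ℂ} (hρ : IsState ρ)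
    (U : Matrix.unitaryGroup (A × B) ℂ) (v : A × B → ℂ)
    (hv : (pulledProduct ρ U).mulVec v = 0) : ρ.mulVec v = 0 := by
  have h1 : (marginalProduct (orbit ρ U)).mulVec
      ((U : Matrix (A × B) (A × B) ℂ).mulVec v) = 0 := by
    rw [← orbit_pulledProduct, Matrix.mulVec_mulVec, orbit, mul_assoc, Unitary.coe_star_mul_self,
      mul_one, ← Matrix.mulVec_mulVec, hv, Matrix.mulVec_zero]
  have h2 := ker_marginalProduct_le (isState_orbit hρ U) _ h1
  conv_lhs => rw [← star_mul_orbit_mul ρ U]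
  rw [mul_assoc, ← Matrix.mulVec_mulVec, ← Matrix.mulVec_mulVec, h2, Matrix.mulVec_zero]

theorem isState_quadraticState (hd : 2 < Fintype.card A * Fintype.card B)
    {ρ : Matrix (A × B) (A × B) ℂ} (hρ : IsState ρ) : IsState (quadraticState ρ) := by
  open scoped Matrix.Norms.L2Operator in
  rw [← integral_pulledProduct hd hρ]
  exact isState_convex.integral_mem isState_isClosed
    (Filter.Eventually.of_forall (isState_pulledProduct hρ))
    (integrable_unitaryHaar (continuous_pulledProduct ρ))

theorem re_integral_trace_mul_pulledProduct (hd : 2 < Fintype.card A * Fintype.card B)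
    {ρ : Matrix (A × B) (A × B) ℂ} (hρ : IsState ρ) (X : Matrix (A × B) (A × B) ℂ) :
    ∫ U, (X * pulledProduct ρ U).trace.re ∂(unitaryHaar (A × B)) =
      (X * quadraticState ρ).trace.re := by
  open scoped Matrix.Norms.L2Operator in
  rw [← integral_pulledProduct hd hρ]
  let L : Matrix (A × B) (A × B) ℂ →L[ℝ] ℝ := LinearMap.toContinuousLinearMap
    { toFun := fun M => (X * M).trace.re
      map_add' := fun M N => by simp [mul_add]
      map_smul' := fun c M => by simp }
  exact L.integral_comp_comm (integrable_unitaryHaar (continuous_pulledProduct ρ))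

/-- The support of `ρ` lies in that of `c₀ + c₁ ρ + c₂ ρ²`: a vector annihilated by an average of
positive matrices is annihilated by at least one of them. -/
theorem ker_quadraticState_le (hd : 2 < Fintype.card A * Fintype.card B)
    {ρ : Matrix (A × B) (A × B) ℂ} (hρ : IsState ρ) (v : A × B → ℂ)
    (hv : (quadraticState ρ).mulVec v = 0) : ρ.mulVec v = 0 := by
  have hquad : ∀ M : Matrix (A × B) (A × B) ℂ,
      (Matrix.vecMulVec v (star v) * M).trace = star v ⬝ᵥ M.mulVec v := by
    intro M
    rw [Matrix.vecMulVec_mul, Matrix.trace_vecMulVec, dotProduct_comm, Matrix.dotProduct_mulVec]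
  have h := re_integral_trace_mul_pulledProduct hd hρ (Matrix.vecMulVec v (star v))
  simp_rw [hquad] at h
  rw [hv, dotProduct_zero, Complex.zero_re] at h
  have hpos : ∀ U, 0 ≤ star v ⬝ᵥ (pulledProduct ρ U).mulVec v := fun U =>
    (isState_pulledProduct hρ U).posSemidef.dotProduct_mulVec_nonneg v
  have hae := (integral_eq_zero_iff_of_nonneg (fun U => (Complex.le_def.1 (hpos U)).1)
    (integrable_unitaryHaar (by fun_prop))).1 h
  obtain ⟨U, hU⟩ := hae.exists
  refine ker_pulledProduct_le hρ U v
    (((isState_pulledProduct hρ U).posSemidef.dotProduct_mulVec_zero_iff v).1 ?_)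
  exact Complex.ext hU (Complex.le_def.1 (hpos U)).2.symm

/-- The mutual information is finite along the orbit and is the relative entropy of `ρ` with respect
to the random state `pulledProduct ρ U`. -/
theorem mutualInformation_orbit {ρ : Matrix (A × B) (A × B) ℂ} (hρ : IsState ρ)
    (U : Matrix.unitaryGroup (A × B) ℂ) :
    mutualInformation (orbit ρ U) = (((ρ * cfc Real.log ρ).trace.re -
      (ρ * cfc Real.log (pulledProduct ρ U)).trace.re : ℝ) : EReal) := by
  rw [mutualInformation, relativeEntropy, if_pos (ker_marginalProduct_le (isState_orbit hρ U)),
    ← orbit_pulledProduct, cfc_orbit hρ.posSemidef.isHermitian,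
    cfc_orbit (isState_pulledProduct hρ U).posSemidef.isHermitian, mul_sub, orbit_mul_orbit,
    orbit_mul_orbit, Matrix.trace_sub, trace_orbit, trace_orbit, Complex.sub_re]

theorem integrable_re_trace_mul_log_pulledProduct {ρ : Matrix (A × B) (A × B) ℂ}
    (hρ : IsState ρ) : Integrable (fun U => (ρ * cfc Real.log (pulledProduct ρ U)).trace.re)
      (unitaryHaar (A × B)) := by
  have h : ∀ U, (ρ * cfc Real.log (pulledProduct ρ U)).trace.re =
      (cfc (fun x => x * Real.log x) (marginalA (orbit ρ U))).trace.re +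
        (cfc (fun x => x * Real.log x) (marginalB (orbit ρ U))).trace.re := by
    intro U
    rw [← re_trace_mul_log_marginalProduct (isState_orbit hρ U), ← orbit_pulledProduct,
      cfc_orbit (isState_pulledProduct hρ U).posSemidef.isHermitian, orbit_mul_orbit, trace_orbit]
  simp_rw [h]
  have hA : Continuous fun U => cfc (fun x => x * Real.log x) (marginalA (orbit ρ U)) :=
    (continuousOn_cfc_isState Real.continuous_mul_log.continuousOn).comp_continuous
      (by fun_prop) fun U => isState_marginalA (isState_orbit hρ U)
  have hB : Continuous fun U => cfc (fun x => x * Real.log x) (marginalB (orbit ρ U)) :=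
    (continuousOn_cfc_isState Real.continuous_mul_log.continuousOn).comp_continuous
      (by fun_prop) fun U => isState_marginalB (isState_orbit hρ U)
  exact integrable_unitaryHaar (by fun_prop)

theorem relativeEntropy_quadraticState (hd : 2 < Fintype.card A * Fintype.card B)
    {ρ : Matrix (A × B) (A × B) ℂ} (hρ : IsState ρ) :
    relativeEntropy ρ (quadraticState ρ) = (((ρ * cfc Real.log ρ).trace.re -
      (ρ * cfc Real.log (quadraticState ρ)).trace.re : ℝ) : EReal) := by
  rw [relativeEntropy, if_pos (ker_quadraticState_le hd hρ), mul_sub, Matrix.trace_sub,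
    Complex.sub_re]

theorem integral_re_trace_mul_log_pulledProduct_le (hd : 2 < Fintype.card A * Fintype.card B)
    {ρ : Matrix (A × B) (A × B) ℂ} (hρ : IsState ρ) :
    ∫ U, (ρ * cfc Real.log (pulledProduct ρ U)).trace.re ∂(unitaryHaar (A × B)) ≤
      (ρ * cfc Real.log (quadraticState ρ)).trace.re := by
  open scoped Matrix.Norms.L2Operator in
  have hmean := integral_pulledProduct hd hρ
  have h := integral_re_trace_mul_log_le hρ.posSemidef (continuous_pulledProduct ρ)
    (isState_pulledProduct hρ) (ker_pulledProduct_le hρ)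
    (integrable_re_trace_mul_log_pulledProduct hρ)
    (hmean ▸ (isState_quadraticState hd hρ).posSemidef)
    (hmean ▸ ker_quadraticState_le hd hρ)
  rwa [hmean] at h

theorem fidelity_orbit {ρ : Matrix (A × B) (A × B) ℂ} (hρ : IsState ρ)
    (U : Matrix.unitaryGroup (A × B) ℂ) :
    fidelity (orbit ρ U) (marginalProduct (orbit ρ U)) = fidelity ρ (pulledProduct ρ U) := by
  open scoped MatrixOrder in
  have h0 := sqrt_conj_nonneg ρ (isState_pulledProduct hρ U).posSemidef.nonneg
  rw [fidelity, fidelity, ← orbit_pulledProduct, cfc_orbit hρ.posSemidef.isHermitian,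
    orbit_mul_orbit, orbit_mul_orbit, cfc_orbit (Matrix.nonneg_iff_posSemidef.1 h0).isHermitian,
    trace_orbit]

theorem re_trace_mul_quadraticState {ρ : Matrix (A × B) (A × B) ℂ} (hρ : IsState ρ) :
    (ρ * quadraticState ρ).trace.re =
      c₀ (Fintype.card A) (Fintype.card B) (ρ ^ 2).trace.re
        + c₁ (Fintype.card A) (Fintype.card B) * (ρ ^ 2).trace.re
        + c₂ (Fintype.card A) (Fintype.card B) * (ρ ^ 3).trace.re := by
  rw [quadraticState, mul_add, mul_add, Matrix.mul_smul, Matrix.mul_smul, Matrix.mul_smul, mul_one,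
    ← pow_two, ← pow_succ', Matrix.trace_add, Matrix.trace_add, Matrix.trace_smul,
    Matrix.trace_smul, Matrix.trace_smul, hρ.trace_eq_one]
  simp

end OrbitAverage

end UnitaryOrbit

end

theorem proposition2 {A B : Type*} [Fintype A] [DecidableEq A] [Fintype B] [DecidableEq B]
    (hd : 2 < Fintype.card A * Fintype.card B)
    (ρ : Matrix (A × B) (A × B) ℂ) (hρ : IsState ρ) :
    -- the average mutual information (which is finite at every point of the orbit)
    ((∀ U, mutualInformation (orbit ρ U) ≠ ⊤) ∧
      Integrable (fun U => (mutualInformation (orbit ρ U)).toReal) (unitaryHaar (A × B)) ∧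
      relativeEntropy ρ (quadraticState ρ) ≤
        ((∫ U, (mutualInformation (orbit ρ U)).toReal ∂(unitaryHaar (A × B)) : ℝ) : EReal)) ∧
    -- the maximal mutual information in the orbit obeys the same lower bound
    (∃ U, relativeEntropy ρ (quadraticState ρ) ≤ mutualInformation (orbit ρ U)) ∧
    -- the average fidelity
    (Integrable (fun U => fidelity (orbit ρ U) (marginalProduct (orbit ρ U)))
        (unitaryHaar (A × B)) ∧
      c₀ (Fintype.card A) (Fintype.card B) (ρ ^ 2).trace.re
          + c₁ (Fintype.card A) (Fintype.card B) * (ρ ^ 2).trace.re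
          + c₂ (Fintype.card A) (Fintype.card B) * (ρ ^ 3).trace.re ≤
        ∫ U, fidelity (orbit ρ U) (marginalProduct (orbit ρ U)) ∂(unitaryHaar (A × B)) ∧
      ∫ U, fidelity (orbit ρ U) (marginalProduct (orbit ρ U)) ∂(unitaryHaar (A × B)) ≤
        fidelity ρ (quadraticState ρ)) := by
  have hI : ∀ U, mutualInformation (orbit ρ U) = (((ρ * cfc Real.log ρ).trace.re -
      (ρ * cfc Real.log (pulledProduct ρ U)).trace.re : ℝ) : EReal) := mutualInformation_orbit hρ
  have hint : Integrable (fun U => (mutualInformation (orbit ρ U)).toReal)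
      (unitaryHaar (A × B)) := by
    simp_rw [hI, EReal.toReal_coe]
    exact (integrable_const _).sub (integrable_re_trace_mul_log_pulledProduct hρ)
  have hbound : relativeEntropy ρ (quadraticState ρ) ≤
      ((∫ U, (mutualInformation (orbit ρ U)).toReal ∂(unitaryHaar (A × B)) : ℝ) : EReal) := by
    rw [relativeEntropy_quadraticState hd hρ, EReal.coe_le_coe_iff]
    simp_rw [hI, EReal.toReal_coe]
    rw [integral_sub (integrable_const _) (integrable_re_trace_mul_log_pulledProduct hρ)]
    have h := integral_re_trace_mul_log_pulledProduct_le hd hρ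
    simp only [integral_const, probReal_univ, one_smul]
    linarith
  refine ⟨⟨fun U => by rw [hI]; exact EReal.coe_ne_top _, hint, hbound⟩, ?_, ?_⟩
  · obtain ⟨U, hU⟩ := exists_integral_le hint
    refine ⟨U, hbound.trans ((EReal.coe_le_coe_iff.2 hU).trans ?_)⟩
    rw [hI, EReal.toReal_coe]
  · simp_rw [fidelity_orbit hρ]
    have hF : Integrable (fun U => fidelity ρ (pulledProduct ρ U)) (unitaryHaar (A × B)) :=
      integrable_unitaryHaar ((continuousOn_fidelity hρ).comp_continuous
        (continuous_pulledProduct ρ) (isState_pulledProduct hρ))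
    refine ⟨hF, ?_, ?_⟩
    · rw [← re_trace_mul_quadraticState hρ, ← re_integral_trace_mul_pulledProduct hd hρ ρ]
      exact integral_mono (integrable_unitaryHaar (by fun_prop)) hF fun U =>
        re_trace_mul_le_fidelity hρ (isState_pulledProduct hρ U)
    · open scoped Matrix.Norms.L2Operator in
      rw [← integral_pulledProduct hd hρ]
      exact integral_concave_le (concaveOn_fidelity ρ) (continuousOn_fidelity hρ)
        (continuous_pulledProduct ρ) (isState_pulledProduct hρ)
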